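/- Let $n\ge 2$ and let $X=(X_{i,j})_{1\le i<j\le n}$ be a random vector in $[0,\infty)^{\binom n2}$ whose law has a density $f$ with respect to Lebesgue measure such that $\log f$ is concave on $[0,\infty)^{\binom n2}$ (with values in $[-\infty,\infty)$) and $f$ is down-monotone, i.e. $f(x)\ge f(y)$ whenever $0\le x\le y$ coordinatewise. Assume that $X$ has negatively correlated coordinates: for all disjoint sets $I,J$ of pairs $(i,j)$ with $1\le i<j\le n$ and all nonnegative numbers $s_a$ $(a\in I)$, $t_b$ $(b\in J)$, $$\mathbb P\big(\forall a\in I\ |X_a|>s_a,\ \forall b\in J\ |X_b|>t_b\big)\le \mathbb P\big(\forall a\in I\ |X_a|>s_a\big)\,\mathbb P\big(\forall b\in J\ |X_b|>t_b\big).$$ Let $\sigma_{\min},\sigma_{\max}\ge 0$ be given by $\sigma_{\min}^2=\min_{i<j}\mathbb E X_{i,j}^2$ and $\sigma_{\max}^2=\max_{i<j}\mathbb E X_{i,j}^2$. For real $p$, let $G_{X,p}$ be the random graph on the vertices $1,\dots,n$ in which, for $i<j$, $\{i,j\}$ is an edge if and only if $X_{i,j}\le p$. Then for every $\delta\in(0,1)$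 the following hold. (a) There are positive constants $c_1,c_2$ depending only on $\delta$ such that for all $n$, $X$ as above and all $p<c_1\sigma_{\min}\frac{\log n}{n}$, $$\mathbb P(G_{X,p}\text{ has isolated vertices})>1-c_2n^{-\delta}.$$ (b) There are positive constants $C_1,C_2$ depending only on $\delta$ such that for all $n$, $X$ as above and all $p>C_1\sigma_{\max}\frac{\log n}{n}$, $$\mathbb P(G_{X,p}\text{ is connected})>1-C_2n^{-\delta}.$$ -/

import Mathlib

open MeasureTheory

noncomputable section

/-- The index set `{(i, j) : i < j}` of the unordered pairs of vertices; it has `n choose 2`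
elements. -/
abbrev VertexPair (n : ℕ) : Type := {e : Fin n × Fin n // e.1 < e.2}

/-- The nonnegative function `f` on the orthant `[0,∞)^ι` is log-concave: `log f` is concave, with
`log 0 = -∞`. -/
def LogConcaveOnOrthant {ι : Type*} (f : (ι → ℝ) → ℝ) : Prop :=
  (∀ x, 0 ≤ x → 0 ≤ f x) ∧
    ∀ x y, 0 ≤ x → 0 ≤ y → ∀ a b : ℝ, 0 < a → 0 < b → a + b = 1 →
      f x ^ a * f y ^ b ≤ f (a • x + b • y)

/-- `f` is down-monotone on the orthant `[0,∞)^ι` (for the coordinatewise order). -/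
def DownMonotoneOnOrthant {ι : Type*} (f : (ι → ℝ) → ℝ) : Prop :=
  ∀ x y, 0 ≤ x → x ≤ y → f y ≤ f x

/-- The random vector `X` takes values in `[0,∞)^ι` (almost surely) and its law has a density with
respect to Lebesgue measure which is log-concave and down-monotone on `[0,∞)^ι`. -/
def HasLogConcaveDownMonotoneDensity {Ω : Type*} [MeasurableSpace Ω] {ι : Type*} [Fintype ι]
    (P : Measure Ω) (X : Ω → ι → ℝ) : Prop :=
  AEMeasurable X P ∧
    ∃ f : (ι → ℝ) → ℝ, AEMeasurable f (volume.restrict (Set.Ici 0)) ∧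
      LogConcaveOnOrthant f ∧ DownMonotoneOnOrthant f ∧
      P.map X = (volume.restrict (Set.Ici 0)).withDensity fun x => ENNReal.ofReal (f x)

/-- Negatively correlated coordinates. -/
def NegativelyCorrelated {Ω : Type*} [MeasurableSpace Ω] {ι : Type*}
    (P : Measure Ω) (X : Ω → ι → ℝ) : Prop :=
  ∀ I J : Finset ι, Disjoint I J → ∀ s t : ι → ℝ, (∀ i ∈ I, 0 ≤ s i) → (∀ j ∈ J, 0 ≤ t j) →
    P.real {ω | (∀ i ∈ I, s i < |X ω i|) ∧ ∀ j ∈ J, t j < |X ω j|} ≤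
      P.real {ω | ∀ i ∈ I, s i < |X ω i|} * P.real {ω | ∀ j ∈ J, t j < |X ω j|}

/-- `σ_min`, the square root of the least second moment of a coordinate. -/
def sigmaMin {Ω : Type*} [MeasurableSpace Ω] {ι : Type*} (P : Measure Ω) (X : Ω → ι → ℝ) : ℝ :=
  √(⨅ e, ∫ ω, X ω e ^ 2 ∂P)

/-- `σ_max`, the square root of the largest second moment of a coordinate. -/
def sigmaMax {Ω : Type*} [MeasurableSpace Ω] {ι : Type*} (P : Measure Ω) (X : Ω → ι → ℝ) : ℝ :=
  √(⨆ e, ∫ ω, X ω e ^ 2 ∂P)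

/-- The graph on `n` vertices in which, for `i < j`, `{i, j}` is an edge iff `x (i, j) ≤ p`. -/
def thresholdGraph {n : ℕ} (x : VertexPair n → ℝ) (p : ℝ) : SimpleGraph (Fin n) :=
  SimpleGraph.fromRel fun i j => ∃ h : i < j, x ⟨(i, j), h⟩ ≤ p

/-- The graph has at least one isolated vertex. -/
def HasIsolatedVertex {V : Type*} (G : SimpleGraph V) : Prop :=
  ∃ v, G.IsIsolated v

end

/-! Upper bounds for joint tails come from negative correlation, lower bounds from log-concavity;
each half of the theorem needs one-dimensional estimates together with one or both of these.

Connectivity is a union bound over cuts. A decreasing density with second moment at most `σ ^ 2`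
puts mass at least `3/8 * (s / σ)` on `[0, s]` for `s ≤ 2 * σ` (`LCMeasure.measureReal_lt_le`). By
negative correlation the probability that a cut carries no edge is at most the product over its
pairs. A set `S` with at most `n / 2` vertices has at least `|S| * n / 2` pairs in its cut, so at `s
= 16 * σ * log n / n` the product is at most `n ^ (-3 * |S|)`, which sums over `S` to at most `2 /
n`.

Isolated vertices come from the second moment method. The first moment needs a lower bound: all
coordinates in `I` exceed `t * σ / 176` with probability at least `exp (-7 * t * |I|)`
(`LCMeasure.exp_le_survival_finset`). Its core is that the density has dropped from its maximum by
at most a factor `64 ^ |I|` at a point whose coordinates are comparable to `σ`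
(`LCDensity.le_apply_of_half_le`). Hence the expected number of empty stars is at least `n ^ δ`. For
the second moment, two stars share exactly one pair. Once it is removed from one of them negative
correlation applies, and `LCMeasure.measureReal_erase_mul_le` shows that the removal costs only a
factor `1 - O(log² n / n)`.

Log-concavity of marginals and survival functions is the Prékopa–Leindler inequality. For antitone
functions it is elementary: superlevel sets on the half-line are initial intervals, whose lengths
add under Minkowski sums, and the orthant follows by integrating one coordinate at a time. -/

open scoped ENNReal Topology

/-! ### Prékopa–Leindler for antitone functions on the half-line -/

/-- Lebesgue measure on the half-line `[0,∞)`. -/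
noncomputable abbrev halfLine : Measure ℝ := volume.restrict (Set.Ici 0)

theorem ENNReal.geom_mean_le_arith_mean2 {a b : ℝ} (ha : 0 < a) (hb : 0 < b) (hab : a + b = 1)
    (x y : ℝ≥0∞) : x ^ a * y ^ b ≤ ENNReal.ofReal a * x + ENNReal.ofReal b * y := by
  have hpq : (a⁻¹).HolderConjugate b⁻¹ := by
    rw [Real.holderConjugate_iff]
    refine ⟨?_, by simpa using hab⟩
    exact (one_lt_inv₀ ha).2 (by linarith)
  have h := ENNReal.young_inequality (x ^ a) (y ^ b) hpq
  rw [← ENNReal.rpow_mul, ← ENNReal.rpow_mul, mul_inv_cancel₀ ha.ne', mul_inv_cancel₀ hb.ne',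
    ENNReal.rpow_one, ENNReal.rpow_one, ENNReal.ofReal_inv_of_pos ha, ENNReal.ofReal_inv_of_pos hb,
    div_eq_mul_inv, div_eq_mul_inv, inv_inv, inv_inv, mul_comm x, mul_comm y] at h
  exact h

/-- Layer cake formula for functions with values in `[0, ∞]`. -/
theorem lintegral_eq_lintegral_measure_ofReal_lt {α : Type*} [MeasurableSpace α] (μ : Measure α)
    [SFinite μ] {u : α → ℝ≥0∞} (hu : Measurable u) :
    ∫⁻ x, u x ∂μ = ∫⁻ l in Set.Ici (0 : ℝ), μ {x | ENNReal.ofReal l < u x} := by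
  have hm : MeasurableSet {q : α × ℝ | ENNReal.ofReal q.2 < u q.1} :=
    measurableSet_lt (ENNReal.measurable_ofReal.comp measurable_snd) (hu.comp measurable_fst)
  have h1 : ∀ c : ℝ≥0∞, volume.restrict (Set.Ici (0 : ℝ)) {l | ENNReal.ofReal l < c} = c := by
    intro c
    rw [Measure.restrict_apply (measurableSet_lt ENNReal.measurable_ofReal measurable_const)]
    rcases eq_or_ne c ⊤ with rfl | hc
    · simp
    · have : {l | ENNReal.ofReal l < c} ∩ Set.Ici (0 : ℝ) = Set.Ico 0 c.toReal := by
        ext l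
        simp only [Set.mem_inter_iff, Set.mem_ofPred_eq, Set.mem_Ici, Set.mem_Ico]
        constructor
        · rintro ⟨h, h0⟩
          exact ⟨h0, (ENNReal.ofReal_lt_iff_lt_toReal h0 hc).1 h⟩
        · rintro ⟨h0, h⟩
          exact ⟨(ENNReal.ofReal_lt_iff_lt_toReal h0 hc).2 h, h0⟩
      rw [this, Real.volume_Ico, sub_zero, ENNReal.ofReal_toReal hc]
  calc ∫⁻ x, u x ∂μ
      = ∫⁻ x, (volume.restrict (Set.Ici (0 : ℝ)))
          (Prod.mk x ⁻¹' {q : α × ℝ | ENNReal.ofReal q.2 < u q.1}) ∂μ := by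
        refine lintegral_congr fun x => ?_
        exact (h1 (u x)).symm
    _ = (μ.prod (volume.restrict (Set.Ici (0 : ℝ)))) {q : α × ℝ | ENNReal.ofReal q.2 < u q.1} :=
        (Measure.prod_apply hm).symm
    _ = _ := Measure.prod_apply_symm hm

theorem halfLine_le_iSup (U : Set ℝ) :
    halfLine U ≤ ⨆ s ∈ U ∩ Set.Ici 0, ENNReal.ofReal s := by
  rcases eq_or_ne (⨆ s ∈ U ∩ Set.Ici 0, ENNReal.ofReal s) ⊤ with h | h
  · rw [h]; exact le_top
  · have hsub : U ∩ Set.Ici 0 ⊆ Set.Icc 0 (⨆ s ∈ U ∩ Set.Ici 0, ENNReal.ofReal s).toReal := by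
      intro s hs
      refine ⟨hs.2, (ENNReal.ofReal_le_iff_le_toReal h).1 ?_⟩
      exact le_iSup₂ (f := fun s (_ : s ∈ U ∩ Set.Ici 0) => ENNReal.ofReal s) s hs
    rw [Measure.restrict_apply' measurableSet_Ici]
    refine (measure_mono hsub).trans ?_
    rw [Real.volume_Icc, sub_zero, ENNReal.ofReal_toReal h]

/-- One-dimensional Brunn–Minkowski inequality for initial intervals of the half-line. -/
theorem halfLine_add_le {a b : ℝ} (ha : 0 < a) (hb : 0 < b) {U V W : Set ℝ}
    (hU : ∃ s ∈ U, 0 ≤ s) (hV : ∃ s ∈ V, 0 ≤ s) (hW : IsLowerSet W)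
    (h : ∀ s ∈ U, ∀ t ∈ V, 0 ≤ s → 0 ≤ t → a * s + b * t ∈ W) :
    ENNReal.ofReal a * halfLine U + ENNReal.ofReal b * halfLine V ≤ halfLine W := by
  refine (add_le_add (mul_le_mul_right (halfLine_le_iSup U) _)
    (mul_le_mul_right (halfLine_le_iSup V) _)).trans ?_
  simp_rw [ENNReal.mul_iSup]
  obtain ⟨s₀, hs₀, hs₀'⟩ := hU
  obtain ⟨t₀, ht₀, ht₀'⟩ := hV
  refine ENNReal.biSup_add_biSup_le' (p := fun s => s ∈ U ∩ Set.Ici 0)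
    (q := fun t => t ∈ V ∩ Set.Ici 0) ⟨s₀, hs₀, hs₀'⟩ ⟨t₀, ht₀, ht₀'⟩ ?_
  intro s hs t ht
  have hs0 : 0 ≤ s := hs.2
  have ht0 : 0 ≤ t := ht.2
  rw [← ENNReal.ofReal_mul ha.le, ← ENNReal.ofReal_mul hb.le,
    ← ENNReal.ofReal_add (by positivity) (by positivity)]
  have : Set.Icc 0 (a * s + b * t) ⊆ W ∩ Set.Ici 0 :=
    fun r hr => ⟨hW hr.2 (h s hs.1 t ht.1 hs0 ht0), hr.1⟩
  rw [Measure.restrict_apply' measurableSet_Ici]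
  calc _ = volume (Set.Icc 0 (a * s + b * t)) := by rw [Real.volume_Icc, sub_zero]
    _ ≤ _ := measure_mono this

/-- Layer cake plus Brunn–Minkowski on superlevel sets. The normalization makes the superlevel sets
of `u` and `v` nonempty at the same levels `l < 1`, which Brunn–Minkowski requires, and null at all
levels `l ≥ 1`. This yields an arithmetic mean on the left, stronger than the geometric one. -/
theorem arith_mean_lintegral_le_of_antitone {a b : ℝ} (ha : 0 < a) (hb : 0 < b)
    {u v w : ℝ → ℝ≥0∞} (hu : Antitone u) (hv : Antitone v) (hw : Antitone w)
    (hu0 : u 0 = 1) (hv0 : v 0 = 1)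
    (hu1 : ∀ s, 0 ≤ s → u s ≤ 1) (hv1 : ∀ s, 0 ≤ s → v s ≤ 1)
    (hab : a + b = 1)
    (h : ∀ s t, 0 ≤ s → 0 ≤ t → u s ^ a * v t ^ b ≤ w (a * s + b * t)) :
    ENNReal.ofReal a * ∫⁻ s, u s ∂halfLine + ENNReal.ofReal b * ∫⁻ s, v s ∂halfLine
      ≤ ∫⁻ s, w s ∂halfLine := by
  have hmeas : ∀ {u : ℝ → ℝ≥0∞}, Antitone u →
      Measurable fun l : ℝ => halfLine {x | ENNReal.ofReal l < u x} := by
    intro u _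
    have : Antitone fun l : ℝ => halfLine {x | ENNReal.ofReal l < u x} := by
      intro l l' hl
      exact measure_mono fun x hx => lt_of_le_of_lt (ENNReal.ofReal_le_ofReal hl) hx
    exact this.measurable
  rw [lintegral_eq_lintegral_measure_ofReal_lt _ hu.measurable,
    lintegral_eq_lintegral_measure_ofReal_lt _ hv.measurable,
    lintegral_eq_lintegral_measure_ofReal_lt _ hw.measurable,
    ← lintegral_const_mul _ (hmeas hu), ← lintegral_const_mul _ (hmeas hv),
    ← lintegral_add_left ((hmeas hu).const_mul _)]
  refine setLIntegral_mono (hmeas hw) fun l hl => ?_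
  have hl0 : 0 ≤ l := hl
  rcases lt_or_ge l 1 with hl1 | hl1
  · have hl1' : ENNReal.ofReal l < 1 := by simpa using hl1
    refine halfLine_add_le ha hb ⟨0, by simpa [hu0] using hl1, le_rfl⟩
      ⟨0, by simpa [hv0] using hl1, le_rfl⟩ ?_ ?_
    · intro x y hyx hx
      exact lt_of_lt_of_le hx (hw hyx)
    · intro s hs t ht hs0 ht0
      refine lt_of_lt_of_le ?_ (h s t hs0 ht0)
      calc ENNReal.ofReal l = ENNReal.ofReal l ^ a * ENNReal.ofReal l ^ b := by
            rw [← ENNReal.rpow_add_of_nonneg _ _ ha.le hb.le, hab, ENNReal.rpow_one]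
        _ < u s ^ a * v t ^ b :=
            ENNReal.mul_lt_mul (ENNReal.rpow_lt_rpow hs ha) (ENNReal.rpow_lt_rpow ht hb)
  · have hz : ∀ {u : ℝ → ℝ≥0∞}, (∀ s, 0 ≤ s → u s ≤ 1) →
        halfLine {x | ENNReal.ofReal l < u x} = 0 := by
      intro u hu1
      have : {x | ENNReal.ofReal l < u x} ∩ Set.Ici 0 = ∅ := by
        ext x
        simp only [Set.mem_inter_iff, Set.mem_ofPred_eq, Set.mem_Ici, Set.mem_empty_iff_false,
          iff_false, not_and]
        intro hx hx0
        have h1 : (1 : ℝ≥0∞) ≤ ENNReal.ofReal l := by simpa using hl1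
        exact absurd (hx.trans_le (hu1 x hx0)) (not_lt.2 h1)
      rw [Measure.restrict_apply' measurableSet_Ici, this, measure_empty]
    rw [hz hu1, hz hv1]
    simp

theorem lintegral_halfLine_eq_top {w : ℝ → ℝ≥0∞} (hw : Antitone w) {t : ℝ} (ht : 0 < t)
    (h : w t = ⊤) : ∫⁻ s, w s ∂halfLine = ⊤ := by
  have h1 : ∫⁻ _ in Set.Icc 0 t, (⊤ : ℝ≥0∞) ≤ ∫⁻ s, w s ∂halfLine := by
    calc ∫⁻ _ in Set.Icc 0 t, (⊤ : ℝ≥0∞) ≤ ∫⁻ s in Set.Icc 0 t, w s :=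
          setLIntegral_mono' measurableSet_Icc fun s hs => by rw [← h]; exact hw hs.2
      _ ≤ _ := lintegral_mono' (Measure.restrict_mono (fun x hx => hx.1) le_rfl) le_rfl
  rw [lintegral_const] at h1
  simpa [ht] using h1

theorem exists_pos_of_lintegral_halfLine_ne_zero {v : ℝ → ℝ≥0∞}
    (h : ∫⁻ s, v s ∂halfLine ≠ 0) : ∃ t, 0 < t ∧ v t ≠ 0 := by
  by_contra! hc
  apply h
  change ∫⁻ s in Set.Ici (0 : ℝ), v s = 0
  rw [← restrict_Ioi_eq_restrict_Ici, setLIntegral_congr_fun (g := fun _ => 0) measurableSet_Ioi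
    (fun s hs => hc s hs)]
  simp

/-- The Prékopa–Leindler inequality for antitone functions on the half-line. -/
theorem prekopaLeindler_halfLine {a b : ℝ} (ha : 0 < a) (hb : 0 < b) (hab : a + b = 1)
    {u v w : ℝ → ℝ≥0∞} (hu : Antitone u) (hv : Antitone v) (hw : Antitone w)
    (h : ∀ s t, 0 ≤ s → 0 ≤ t → u s ^ a * v t ^ b ≤ w (a * s + b * t)) :
    (∫⁻ s, u s ∂halfLine) ^ a * (∫⁻ s, v s ∂halfLine) ^ b ≤ ∫⁻ s, w s ∂halfLine := by
  rcases eq_or_ne (∫⁻ s, u s ∂halfLine) 0 with hIu | hIu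
  · simp [hIu, ha]
  rcases eq_or_ne (∫⁻ s, v s ∂halfLine) 0 with hIv | hIv
  · simp [hIv, hb]
  obtain ⟨s₁, hs₁, hus⟩ := exists_pos_of_lintegral_halfLine_ne_zero hIu
  obtain ⟨t₁, ht₁, hvt⟩ := exists_pos_of_lintegral_halfLine_ne_zero hIv
  -- An infinite value at the origin cannot be normalized away; it forces `w` to be infinite at a
  -- positive point, hence on an initial interval, so the right-hand side is infinite.
  rcases eq_or_ne (u 0) ⊤ with hu0 | hu0
  · have : w (a * 0 + b * t₁) = ⊤ := by
      refine top_le_iff.1 (le_trans ?_ (h 0 t₁ le_rfl ht₁.le))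
      rw [hu0, ENNReal.top_rpow_of_pos ha, ENNReal.top_mul]
      simp [hvt, hb.le]
    rw [lintegral_halfLine_eq_top hw (by positivity) this]
    exact le_top
  rcases eq_or_ne (v 0) ⊤ with hv0 | hv0
  · have : w (a * s₁ + b * 0) = ⊤ := by
      refine top_le_iff.1 (le_trans ?_ (h s₁ 0 hs₁.le le_rfl))
      rw [hv0, ENNReal.top_rpow_of_pos hb, ENNReal.mul_top]
      simp [hus, ha.le]
    rw [lintegral_halfLine_eq_top hw (by positivity) this]
    exact le_top
  have hu0' : u 0 ≠ 0 := fun h0 => hus (le_antisymm (h0 ▸ hu hs₁.le) bot_le)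
  have hv0' : v 0 ≠ 0 := fun h0 => hvt (le_antisymm (h0 ▸ hv ht₁.le) bot_le)
  have hscale : ∀ {u : ℝ → ℝ≥0∞} (c : ℝ≥0∞), Antitone u → Antitone fun s => c * u s :=
    fun c hu s t hst => mul_le_mul_right (hu hst) c
  -- Both functions are scaled to have value 1 at the origin and `w` is scaled by the matching
  -- geometric mean, so that the scaling factor cancels at the end.
  have key := arith_mean_lintegral_le_of_antitone ha hb (hscale (u 0)⁻¹ hu) (hscale (v 0)⁻¹ hv)
    (hscale ((u 0)⁻¹ ^ a * (v 0)⁻¹ ^ b) hw)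
    (ENNReal.inv_mul_cancel hu0' hu0) (ENNReal.inv_mul_cancel hv0' hv0)
    (fun s hs => by
      rw [← ENNReal.inv_mul_cancel hu0' hu0]; exact mul_le_mul_right (hu hs) _)
    (fun s hs => by
      rw [← ENNReal.inv_mul_cancel hv0' hv0]; exact mul_le_mul_right (hv hs) _) hab
    (fun s t hs ht => by
      rw [ENNReal.mul_rpow_of_nonneg _ _ ha.le, ENNReal.mul_rpow_of_nonneg _ _ hb.le]
      calc _ = (u 0)⁻¹ ^ a * (v 0)⁻¹ ^ b * (u s ^ a * v t ^ b) := by ring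
        _ ≤ _ := mul_le_mul_right (h s t hs ht) _)
  have key2 := (ENNReal.geom_mean_le_arith_mean2 ha hb hab _ _).trans key
  rw [lintegral_const_mul _ hu.measurable, lintegral_const_mul _ hv.measurable,
    lintegral_const_mul _ hw.measurable, ENNReal.mul_rpow_of_nonneg _ _ ha.le,
    ENNReal.mul_rpow_of_nonneg _ _ hb.le] at key2
  set M := (u 0)⁻¹ ^ a * (v 0)⁻¹ ^ b with hM
  have hM0 : M ≠ 0 := by
    refine mul_ne_zero ?_ ?_
    · exact (ENNReal.rpow_pos (by simpa using hu0) (by simpa using hu0')).ne'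
    · exact (ENNReal.rpow_pos (by simpa using hv0) (by simpa using hv0')).ne'
  have hMt : M ≠ ⊤ := by
    refine ENNReal.mul_ne_top ?_ ?_
    · exact ENNReal.rpow_ne_top_of_nonneg ha.le (by simpa using hu0')
    · exact ENNReal.rpow_ne_top_of_nonneg hb.le (by simpa using hv0')
  refine (ENNReal.mul_le_mul_iff_right hM0 hMt).1 ?_
  refine le_trans (le_of_eq ?_) key2
  rw [hM]; ring

/-! ### Prékopa–Leindler on the orthant -/

/-- Lebesgue measure on the orthant `[0,∞)^κ`. -/
noncomputable abbrev orthant (κ : Type*) [Fintype κ] : Measure (κ → ℝ) :=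
  Measure.pi fun _ => halfLine

theorem orthant_eq_restrict (κ : Type*) [Fintype κ] :
    orthant κ = volume.restrict (Set.Ici 0) := by
  rw [volume_pi, ← Set.pi_univ_Ici, Measure.restrict_pi_pi]
  rfl

/-- The hypothesis `f(x)^a g(y)^b ≤ h(ax+by)` of the Prékopa–Leindler inequality, on the orthant. -/
def PLBound {κ : Type*} (a b : ℝ) (f g h : (κ → ℝ) → ℝ≥0∞) : Prop :=
  ∀ x y, 0 ≤ x → 0 ≤ y → f x ^ a * g y ^ b ≤ h (a • x + b • y)

theorem Antitone.lmarginal {κ : Type*} [DecidableEq κ] {f : (κ → ℝ) → ℝ≥0∞} (hf : Antitone f)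
    (s : Finset κ) : Antitone (lmarginal (fun _ => halfLine) s f) := by
  intro x y hxy
  refine lintegral_mono fun z => hf ?_
  intro i
  by_cases hi : i ∈ s
  · simp [Function.updateFinset, hi]
  · simpa [Function.updateFinset, hi] using hxy i

/-- Tensorization: each induction step applies the half-line inequality in one coordinate with the
others frozen. Partial integrals stay antitone, so the half-line inequality remains applicable. -/
theorem PLBound.lmarginal {κ : Type*} [DecidableEq κ] {a b : ℝ} (ha : 0 < a) (hb : 0 < b)
    (hab : a + b = 1) {f g h : (κ → ℝ) → ℝ≥0∞} (hf : Measurable f) (hg : Measurable g)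
    (hh : Measurable h) (hfa : Antitone f) (hga : Antitone g) (hha : Antitone h)
    (H : PLBound a b f g h) (s : Finset κ) :
    PLBound a b (lmarginal (fun _ => halfLine) s f) (lmarginal (fun _ => halfLine) s g)
      (lmarginal (fun _ => halfLine) s h) := by
  induction s using Finset.induction_on with
  | empty => simpa using H
  | insert i s hi ih =>
    intro x y hx hy
    rw [lmarginal_insert f hf hi, lmarginal_insert g hg hi, lmarginal_insert h hh hi]
    have hup : ∀ {x : κ → ℝ} {s t : ℝ}, s ≤ t → Function.update x i s ≤ Function.update x i t :=
      fun hst => update_le_update_iff.2 ⟨hst, fun _ _ => le_rfl⟩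
    refine prekopaLeindler_halfLine ha hb hab (fun _ _ hst => hfa.lmarginal s (hup hst))
      (fun _ _ hst => hga.lmarginal s (hup hst)) (fun _ _ hst => hha.lmarginal s (hup hst)) ?_
    intro p q hp hq
    have hnn : ∀ {x : κ → ℝ} {p : ℝ}, 0 ≤ x → 0 ≤ p → 0 ≤ Function.update x i p := by
      intro x p hx hp j
      rcases eq_or_ne j i with rfl | hj
      · simpa using hp
      · simpa [hj] using hx j
    refine (ih _ _ (hnn hx hp) (hnn hy hq)).trans (le_of_eq ?_)
    congr 1
    ext j
    rcases eq_or_ne j i with rfl | hj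
    · simp
    · simp [hj]

/-- The Prékopa–Leindler inequality for antitone functions on the orthant. -/
theorem PLBound.lintegral {κ : Type*} [Fintype κ] {a b : ℝ} (ha : 0 < a) (hb : 0 < b)
    (hab : a + b = 1) {f g h : (κ → ℝ) → ℝ≥0∞} (hf : Measurable f) (hg : Measurable g)
    (hh : Measurable h) (hfa : Antitone f) (hga : Antitone g) (hha : Antitone h)
    (H : PLBound a b f g h) :
    (∫⁻ x, f x ∂orthant κ) ^ a * (∫⁻ x, g x ∂orthant κ) ^ b ≤ ∫⁻ x, h x ∂orthant κ := by
  classical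
  have := PLBound.lmarginal ha hb hab hf hg hh hfa hga hha H Finset.univ 0 0 le_rfl le_rfl
  simpa using this

/-! ### Marginals and survival functions of log-concave antitone measures -/

/-- A measurable, antitone density that is log-concave on the orthant. -/
structure LCDensity {κ : Type*} (F : (κ → ℝ) → ℝ≥0∞) : Prop where
  measurable : Measurable F
  antitone : Antitone F
  logConcave : ∀ a b : ℝ, 0 < a → 0 < b → a + b = 1 → PLBound a b F F F

/-- A measure on the orthant with a log-concave antitone density. -/
def LCMeasure {κ : Type*} [Fintype κ] (Q : Measure (κ → ℝ)) : Prop :=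
  ∃ F : (κ → ℝ) → ℝ≥0∞, LCDensity F ∧ Q = (orthant κ).withDensity F

/-- Marginals of log-concave antitone measures are log-concave and antitone. -/
theorem LCMeasure.map_subtype {κ : Type*} [Fintype κ] {Q : Measure (κ → ℝ)} (hQ : LCMeasure Q)
    (p : κ → Prop) [DecidablePred p] :
    LCMeasure (Q.map fun x (i : {i // p i}) => x i) := by
  obtain ⟨F, hF, rfl⟩ := hQ
  let e := MeasurableEquiv.piEquivPiSubtypeProd (fun _ : κ => ℝ) p
  have he : MeasurePreserving e (orthant κ) ((orthant {i // p i}).prod (orthant {i // ¬ p i})) :=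
    measurePreserving_piEquivPiSubtypeProd (fun _ : κ => halfLine) p
  have hes : ∀ x y i, e.symm (x, y) i = if h : p i then x ⟨i, h⟩ else y ⟨i, h⟩ := fun x y i => rfl
  have hmono : ∀ {x x' y y'}, x ≤ x' → y ≤ y' → e.symm (x, y) ≤ e.symm (x', y') := by
    intro x x' y y' hx hy i
    rw [hes, hes]
    split_ifs with h
    · exact hx _
    · exact hy _
  have hnn : ∀ {x y}, 0 ≤ x → 0 ≤ y → 0 ≤ e.symm (x, y) := by
    intro x y hx hy i
    rw [hes]
    split_ifs with h
    · exact hx _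
    · exact hy _
  have hFm : Measurable fun q : ({i // p i} → ℝ) × ({i // ¬ p i} → ℝ) => F (e.symm q) :=
    hF.measurable.comp e.symm.measurable
  have hm1 : ∀ x, Measurable fun y => F (e.symm (x, y)) := fun x => hFm.comp (by fun_prop)
  refine ⟨fun x => ∫⁻ y, F (e.symm (x, y)) ∂orthant {i // ¬ p i},
    ⟨hFm.lintegral_prod_right', fun x x' h => ?_, ?_⟩, ?_⟩
  · exact lintegral_mono fun y => hF.antitone (hmono h le_rfl)
  · intro a b ha hb hab x x' hx hx'
    -- Prékopa–Leindler on the fibres over `x`, `x'` and `a • x + b • x'`.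
    refine PLBound.lintegral ha hb hab (hm1 _) (hm1 _) (hm1 _)
      (fun y y' h => hF.antitone (hmono le_rfl h)) (fun y y' h => hF.antitone (hmono le_rfl h))
      (fun y y' h => hF.antitone (hmono le_rfl h)) ?_
    intro y y' hy hy'
    refine (hF.logConcave a b ha hb hab _ _ (hnn hx hy) (hnn hx' hy')).trans (le_of_eq ?_)
    congr 1
    ext i
    simp only [Pi.add_apply, Pi.smul_apply, hes, smul_eq_mul]
    split_ifs <;> rfl
  · ext A hA
    have hmr : Measurable fun x (i : {i // p i}) => (x : κ → ℝ) i := by fun_prop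
    rw [Measure.map_apply hmr hA, withDensity_apply _ (hmr hA), withDensity_apply _ hA,
      ← lintegral_indicator (hmr hA), ← lintegral_indicator hA,
      ← he.symm.lintegral_comp_emb e.symm.measurableEmbedding,
      lintegral_prod (fun q => ((fun (x : κ → ℝ) (i : {i // p i}) => x i) ⁻¹' A).indicator F
        (e.symm q)) ((hF.measurable.indicator (hmr hA)).comp e.symm.measurable).aemeasurable]
    refine lintegral_congr fun x => ?_
    have hx : ∀ y, (fun i : {i // p i} => e.symm (x, y) i) = x := by
      intro y
      ext i
      rw [hes]
      simp [i.2]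
    by_cases hxA : x ∈ A
    · rw [Set.indicator_of_mem hxA]
      refine lintegral_congr fun y => ?_
      rw [Set.indicator_of_mem]
      simpa only [Set.mem_preimage, hx]
    · rw [Set.indicator_of_notMem hxA]
      rw [← lintegral_zero (μ := orthant {i // ¬ p i})]
      refine lintegral_congr fun y => ?_
      rw [Set.indicator_of_notMem]
      simpa only [Set.mem_preimage, hx]

/-- Translation of integrals over the orthant. -/
theorem setLIntegral_orthant_Ici {κ : Type*} [Fintype κ] (F : (κ → ℝ) → ℝ≥0∞) {x : κ → ℝ}
    (hx : 0 ≤ x) :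
    ∫⁻ y in Set.Ici x, F y ∂orthant κ = ∫⁻ y, F (x + y) ∂orthant κ := by
  rw [orthant_eq_restrict, Measure.restrict_restrict measurableSet_Ici,
    Set.inter_eq_left.2 (Set.Ici_subset_Ici.2 hx), ← lintegral_indicator measurableSet_Ici,
    ← lintegral_indicator measurableSet_Ici, ← lintegral_add_left_eq_self _ x]
  refine lintegral_congr fun y => ?_
  have : x + y ∈ Set.Ici x ↔ y ∈ Set.Ici 0 := by simp [Set.mem_Ici]
  by_cases h : y ∈ Set.Ici 0
  · rw [Set.indicator_of_mem h, Set.indicator_of_mem (this.2 h)]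
  · rw [Set.indicator_of_notMem h, Set.indicator_of_notMem (mt this.1 h)]

/-- Scaling of integrals over the orthant. -/
theorem lintegral_orthant_comp_smul {κ : Type*} [Fintype κ] {F : (κ → ℝ) → ℝ≥0∞}
    (hF : Measurable F) {c : ℝ} (hc : 0 < c) :
    ENNReal.ofReal c ^ Fintype.card κ * ∫⁻ y, F (c • y) ∂orthant κ = ∫⁻ y, F y ∂orthant κ := by
  have h := Measure.map_addHaar_smul (volume : Measure (κ → ℝ)) hc.ne'
  have hm : Measurable fun y : κ → ℝ => c • y := measurable_const_smul c
  have h1 : ∫⁻ y, (Set.Ici 0).indicator F (c • y) =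
      ENNReal.ofReal |(c ^ Module.finrank ℝ (κ → ℝ))⁻¹| * ∫⁻ y, (Set.Ici 0).indicator F y := by
    rw [← lintegral_map (hF.indicator measurableSet_Ici) hm, h, lintegral_smul_measure,
      smul_eq_mul]
  have h2 : ∀ y : κ → ℝ, (Set.Ici 0).indicator F (c • y) =
      (Set.Ici 0).indicator (fun y => F (c • y)) y := by
    intro y
    have : c • y ∈ Set.Ici 0 ↔ y ∈ Set.Ici 0 := by
      simp [Set.mem_Ici, Pi.le_def, mul_nonneg_iff_of_pos_left hc]
    by_cases h : y ∈ Set.Ici 0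
    · rw [Set.indicator_of_mem h, Set.indicator_of_mem (this.2 h)]
    · rw [Set.indicator_of_notMem h, Set.indicator_of_notMem (mt this.1 h)]
  simp_rw [h2] at h1
  rw [orthant_eq_restrict, ← lintegral_indicator measurableSet_Ici,
    ← lintegral_indicator measurableSet_Ici, h1, Module.finrank_fintype_fun_eq_card,
    abs_of_pos (by positivity), ← mul_assoc, ← ENNReal.ofReal_pow hc.le,
    ← ENNReal.ofReal_mul (by positivity), mul_inv_cancel₀ (by positivity), ENNReal.ofReal_one,
    one_mul]

/-- The strict upper orthant differs from the upper orthant by a null set. -/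
theorem orthant_setOf_lt_ae_eq_Ici {κ : Type*} [Fintype κ] (x : κ → ℝ) :
    ({y | ∀ i, x i < y i} : Set (κ → ℝ)) =ᵐ[orthant κ] Set.Ici x := by
  have : ∀ᵐ y ∂orthant κ, ∀ i, y i ≠ x i := by
    rw [ae_all_iff]
    intro i
    have : ∀ᵐ r ∂halfLine, r ≠ x i :=
      ae_restrict_of_ae (Measure.ae_ne volume (x i))
    exact (Measure.quasiMeasurePreserving_eval (fun _ : κ => halfLine) i).ae this
  filter_upwards [this] with y hy
  refine propext ⟨fun h i => (h i).le, fun h i => lt_of_le_of_ne (h i) (hy i).symm⟩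

theorem withDensity_setOf_lt {κ : Type*} [Fintype κ] (F : (κ → ℝ) → ℝ≥0∞) {x : κ → ℝ}
    (hx : 0 ≤ x) :
    ((orthant κ).withDensity F) {y | ∀ i, x i < y i} = ∫⁻ y, F (x + y) ∂orthant κ := by
  rw [withDensity_apply', setLIntegral_congr (orthant_setOf_lt_ae_eq_Ici x),
    setLIntegral_orthant_Ici F hx]

/-- Survival functions of log-concave antitone measures are log-concave. -/
theorem LCMeasure.survival_logConcave {κ : Type*} [Fintype κ] {Q : Measure (κ → ℝ)}
    (hQ : LCMeasure Q) {a b : ℝ} (ha : 0 < a) (hb : 0 < b) (hab : a + b = 1) :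
    PLBound a b (fun x => Q {y | ∀ i, x i < y i}) (fun x => Q {y | ∀ i, x i < y i})
      (fun x => Q {y | ∀ i, x i < y i}) := by
  obtain ⟨F, hF, rfl⟩ := hQ
  intro x x' hx hx'
  have hc : 0 ≤ a • x + b • x' := add_nonneg (smul_nonneg ha.le hx) (smul_nonneg hb.le hx')
  simp only [withDensity_setOf_lt F hx, withDensity_setOf_lt F hx', withDensity_setOf_lt F hc]
  have hm : ∀ x : κ → ℝ, Measurable fun y => F (x + y) := fun x =>
    hF.measurable.comp (measurable_const_add x)
  have hant : ∀ x : κ → ℝ, Antitone fun y => F (x + y) := fun x y y' h =>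
    hF.antitone (add_le_add_right h x)
  -- A survival function integrates a translate of `F` over the fixed orthant, so Prékopa–Leindler
  -- applies to the three translates.
  refine PLBound.lintegral ha hb hab (hm _) (hm _) (hm _) (hant _) (hant _) (hant _) ?_
  intro y y' hy hy'
  refine (hF.logConcave a b ha hb hab _ _ (add_nonneg hx hy) (add_nonneg hx' hy')).trans
    (le_of_eq ?_)
  congr 1
  simp only [smul_add]
  abel

/-! ### A Borel version of the density -/

theorem antitone_ofReal_comp_sup_zero {κ : Type*} {f : (κ → ℝ) → ℝ}
    (hf : DownMonotoneOnOrthant f) : Antitone fun x : κ → ℝ => ENNReal.ofReal (f (x ⊔ 0)) :=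
  fun _ _ h => ENNReal.ofReal_le_ofReal (hf _ _ le_sup_right (sup_le_sup_right h 0))

/-- A log-concave down-monotone function on the orthant has a lower semicontinuous, antitone and
log-concave modification. -/
theorem exists_lcDensity_ae_eq {κ : Type*} [Fintype κ] {f : (κ → ℝ) → ℝ}
    (hf : LogConcaveOnOrthant f) (hm : DownMonotoneOnOrthant f) :
    ∃ F : (κ → ℝ) → ℝ≥0∞, LCDensity F ∧
      F =ᵐ[volume.restrict (Set.Ici 0)] fun x => ENNReal.ofReal (f x) := by
  set c : ℕ → κ → ℝ := fun k _ => 1 / ((k : ℝ) + 1) with hc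
  have hc0 : ∀ k, 0 ≤ c k := fun k i => by simp only [hc, Pi.zero_apply]; positivity
  have hcanti : Antitone c := fun k l h i => by
    simp only [hc]
    have : (k : ℝ) ≤ l := by exact_mod_cast h
    gcongr
  set g : (κ → ℝ) → ℝ≥0∞ := fun x => ENNReal.ofReal (f (x ⊔ 0)) with hg
  have hga : Antitone g := antitone_ofReal_comp_sup_zero hm
  have hg0 : ∀ x, 0 ≤ x → g x = ENNReal.ofReal (f x) := fun x hx => by
    simp only [hg, sup_eq_left.2 hx]
  -- The limit of `f` along the diagonal from above. Log-concavity passes to the limit because the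
  -- same shift is added to all three points.
  set F : (κ → ℝ) → ℝ≥0∞ := fun x => ⨆ k, g (x ⊔ 0 + c k) with hF
  have hlsc : ∀ l, IsOpen {x | l < F x} := by
    intro l
    rw [isOpen_iff_mem_nhds]
    intro x hx
    obtain ⟨k, hk⟩ := lt_iSup_iff.1 (show l < ⨆ k, g (x ⊔ 0 + c k) from hx)
    have hev : ∀ᶠ x' : κ → ℝ in 𝓝 x, ∀ i, x' i < x i + 1 / (2 * ((k : ℝ) + 1)) := by
      rw [Filter.eventually_all]
      intro i
      refine (continuous_apply i).continuousAt.eventually_lt continuousAt_const ?_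
      have : 0 < 1 / (2 * ((k : ℝ) + 1)) := by positivity
      linarith
    filter_upwards [hev] with x' hx'
    -- Index `2 * k + 1` halves the shift `c k`, which leaves the other half as room for `x'` to
    -- move.
    refine lt_iSup_iff.2 ⟨2 * k + 1, hk.trans_le (hga ?_)⟩
    intro i
    have h1 := hx' i
    have h2 : (1 : ℝ) / (((2 * k + 1 : ℕ) : ℝ) + 1) = 1 / (2 * ((k : ℝ) + 1)) := by
      push_cast; congr 1; ring
    have h3 : (1 : ℝ) / ((k : ℝ) + 1) = 1 / (2 * ((k : ℝ) + 1)) + 1 / (2 * ((k : ℝ) + 1)) := by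
      field_simp; norm_num
    have h4 : 0 < 1 / (2 * ((k : ℝ) + 1)) := by positivity
    simp only [Pi.add_apply, Pi.sup_apply, Pi.zero_apply, hc]
    rw [h2, h3, ← add_assoc]
    gcongr
    refine sup_le ?_ ?_
    · exact h1.le.trans (by gcongr; exact le_sup_left)
    · exact add_nonneg le_sup_right h4.le
  refine ⟨F, ⟨measurable_of_Ioi fun l => (hlsc l).measurableSet, ?_, ?_⟩, ?_⟩
  · intro x y hxy
    exact iSup_mono fun k => hga (add_le_add_left (sup_le_sup_right hxy 0) _)
  · intro a b ha hb hab x y hx hy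
    have hfin : ∀ x, F x ≠ ⊤ := fun x =>
      ((iSup_le fun k => hga (add_nonneg le_sup_right (hc0 k))).trans_lt
        (ENNReal.ofReal_lt_top (r := f (0 ⊔ 0)))).ne
    have hlim : ∀ (x : κ → ℝ) {p : ℝ}, 0 < p → Filter.Tendsto (fun k => g (x ⊔ 0 + c k) ^ p)
        Filter.atTop (𝓝 (F x ^ p)) := fun x p hp =>
      ((ENNReal.continuous_rpow_const (y := p)).tendsto _).comp
        (tendsto_atTop_iSup fun k l h => hga (add_le_add_right (hcanti h) _))
    refine le_of_tendsto' (ENNReal.Tendsto.mul (hlim x ha)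
      (Or.inr (ENNReal.rpow_ne_top_of_nonneg hb.le (hfin y))) (hlim y hb)
      (Or.inr (ENNReal.rpow_ne_top_of_nonneg ha.le (hfin x)))) fun k => ?_
    have hxy : 0 ≤ a • x + b • y := add_nonneg (smul_nonneg ha.le hx) (smul_nonneg hb.le hy)
    refine le_trans ?_ (le_iSup (fun k => g ((a • x + b • y) ⊔ 0 + c k)) k)
    rw [sup_eq_left.2 hx, sup_eq_left.2 hy, sup_eq_left.2 hxy, hg0 _ (add_nonneg hx (hc0 k)),
      hg0 _ (add_nonneg hy (hc0 k)), hg0 _ (add_nonneg hxy (hc0 k)),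
      ENNReal.ofReal_rpow_of_nonneg (hf.1 _ (add_nonneg hx (hc0 k))) ha.le,
      ENNReal.ofReal_rpow_of_nonneg (hf.1 _ (add_nonneg hy (hc0 k))) hb.le,
      ← ENNReal.ofReal_mul (Real.rpow_nonneg (hf.1 _ (add_nonneg hx (hc0 k))) _)]
    refine ENNReal.ofReal_le_ofReal ((hf.2 _ _ (add_nonneg hx (hc0 k)) (add_nonneg hy (hc0 k))
      a b ha hb hab).trans (le_of_eq ?_))
    congr 1
    calc _ = a • x + b • y + (a + b) • c k := by rw [add_smul, smul_add, smul_add]; abel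
      _ = _ := by rw [hab, one_smul]
  -- Superlevel sets of `g` are lower sets, so their frontiers are null. Off the frontiers of the
  -- countably many rational levels, small upward shifts do not lose a level.
  · have hfr : ∀ᵐ x : κ → ℝ, ∀ q : ℚ,
        x ∉ frontier {x | ((Real.toNNReal q : NNReal) : ℝ≥0∞) < g x} := by
      rw [ae_all_iff]
      intro q
      rw [ae_iff]
      simp only [not_not]
      exact IsLowerSet.null_frontier fun x y hyx hx => lt_of_lt_of_le hx (hga hyx)
    filter_upwards [ae_restrict_of_ae hfr, ae_restrict_mem measurableSet_Ici] with x hx hx0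
    have hx0' : (0 : κ → ℝ) ≤ x := hx0
    rw [← hg0 x hx0']
    have hFx : F x = ⨆ k, g (x + c k) := by simp only [hF, sup_eq_left.2 hx0']
    rw [hFx]
    refine le_antisymm (iSup_le fun k => hga (le_add_of_nonneg_right (hc0 k))) ?_
    refine le_of_forall_lt fun l hl => ?_
    obtain ⟨q, -, hlq, hq⟩ := ENNReal.lt_iff_exists_rat_btwn.1 hl
    have hint : x ∈ interior {x | ((Real.toNNReal q : NNReal) : ℝ≥0∞) < g x} := by
      by_contra hni
      exact hx q ⟨subset_closure hq, hni⟩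
    have hlim : Filter.Tendsto (fun k => x + c k) Filter.atTop (𝓝 x) := by
      rw [tendsto_pi_nhds]
      intro i
      have := (tendsto_one_div_add_atTop_nhds_zero_nat (𝕜 := ℝ)).const_add (x i)
      simpa [hc] using this
    obtain ⟨k, hk⟩ := (hlim.eventually (mem_interior_iff_mem_nhds.1 hint)).exists
    exact hlq.trans (lt_of_lt_of_le hk (le_iSup (fun k => g (x + c k)) k))

theorem HasLogConcaveDownMonotoneDensity.lcMeasure_map {Ω : Type*} [MeasurableSpace Ω] {ι : Type*}
    [Fintype ι] {P : Measure Ω} {X : Ω → ι → ℝ} (h : HasLogConcaveDownMonotoneDensity P X) :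
    LCMeasure (P.map X) := by
  obtain ⟨-, f, -, hlc, hdm, hmap⟩ := h
  obtain ⟨F, hF, hFf⟩ := exists_lcDensity_ae_eq hlc hdm
  exact ⟨F, hF, by rw [hmap, orthant_eq_restrict, withDensity_congr_ae hFf]⟩

/-! ### Lower bounds for joint survival probabilities -/

theorem orthant_ae_nonneg (κ : Type*) [Fintype κ] : ∀ᵐ x ∂orthant κ, 0 ≤ x := by
  rw [orthant_eq_restrict]
  exact ae_restrict_mem measurableSet_Ici

/-- With `m` the dimension, log-concavity between `x` and `0` gives `F x ≤ 8⁻¹ ^ m * F (x / 2)` on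
this set, while `F (x / 2)` has integral `2 ^ m`. The mass is thus at most `4⁻¹ ^ m`. -/
theorem LCDensity.measure_lt_le {κ : Type*} [Fintype κ] [Nonempty κ] {F : (κ → ℝ) → ℝ≥0∞}
    (hF : LCDensity F) (hI : ∫⁻ x, F x ∂orthant κ = 1) :
    (orthant κ).withDensity F {x | F x < (64⁻¹ : ℝ≥0∞) ^ Fintype.card κ * F 0} ≤ 4⁻¹ := by
  set m := Fintype.card κ with hmdef
  have hm : 1 ≤ m := Fintype.card_pos
  have hmeas : MeasurableSet {x | F x < (64⁻¹ : ℝ≥0∞) ^ m * F 0} :=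
    measurableSet_lt hF.measurable measurable_const
  have h8 : ((64⁻¹ : ℝ≥0∞) ^ m) ^ (1 / 2 : ℝ) = (8⁻¹) ^ m := by
    have : (64⁻¹ : ℝ≥0∞) ^ m = ((8⁻¹) ^ m) ^ (2 : ℝ) := by
      have h64 : (64⁻¹ : ℝ≥0∞) = 8⁻¹ ^ 2 := by
        rw [← ENNReal.inv_pow]; norm_num
      rw [ENNReal.rpow_two, h64, ← pow_mul, ← pow_mul, mul_comm]
    rw [this, ← ENNReal.rpow_mul]
    norm_num
  have hsc := lintegral_orthant_comp_smul hF.measurable (c := 1 / 2) (by norm_num)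
  rw [hI, ← hmdef] at hsc
  have h2 : ENNReal.ofReal (1 / 2) = 2⁻¹ := by
    rw [one_div, ENNReal.ofReal_inv_of_pos (by norm_num)]; norm_num
  rw [h2] at hsc
  have hpt : ∀ᵐ x ∂(orthant κ), x ∈ {x | F x < (64⁻¹ : ℝ≥0∞) ^ m * F 0} →
      F x ≤ (8⁻¹) ^ m * F ((1 / 2 : ℝ) • x) := by
    filter_upwards [orthant_ae_nonneg κ] with x hx hlt
    have h1 := hF.logConcave (1 / 2) (1 / 2) (by norm_num) (by norm_num) (by norm_num) x 0 hx le_rfl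
    rw [smul_zero, add_zero] at h1
    calc F x = F x ^ (1 / 2 : ℝ) * F x ^ (1 / 2 : ℝ) := by
          rw [← ENNReal.rpow_add_of_nonneg _ _ (by norm_num) (by norm_num)]; norm_num
      _ ≤ F x ^ (1 / 2 : ℝ) * ((64⁻¹ : ℝ≥0∞) ^ m * F 0) ^ (1 / 2 : ℝ) := by
          gcongr
      _ = (8⁻¹) ^ m * (F x ^ (1 / 2 : ℝ) * F 0 ^ (1 / 2 : ℝ)) := by
          rw [ENNReal.mul_rpow_of_nonneg _ _ (by norm_num), h8]; ring
      _ ≤ _ := by gcongr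
  rw [withDensity_apply _ hmeas]
  calc _ ≤ ∫⁻ x in {x | F x < (64⁻¹ : ℝ≥0∞) ^ m * F 0},
          (8⁻¹) ^ m * F ((1 / 2 : ℝ) • x) ∂orthant κ :=
        setLIntegral_mono_ae' hmeas hpt
    _ ≤ ∫⁻ x, (8⁻¹) ^ m * F ((1 / 2 : ℝ) • x) ∂orthant κ := setLIntegral_le_lintegral _ _
    _ = (8⁻¹) ^ m * ∫⁻ x, F ((1 / 2 : ℝ) • x) ∂orthant κ :=
        lintegral_const_mul _ (hF.measurable.comp (measurable_const_smul _))
    _ = (4⁻¹) ^ m * (2⁻¹ ^ m * ∫⁻ x, F ((1 / 2 : ℝ) • x) ∂orthant κ) := by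
        rw [← mul_assoc, ← mul_pow, ← ENNReal.mul_inv (by simp) (by simp)]
        norm_num
    _ = (4⁻¹) ^ m := by rw [hsc, mul_one]
    _ ≤ (4⁻¹) ^ 1 := pow_le_pow_right_of_le_one' (by simp) hm
    _ = _ := pow_one _

/-- If each coordinate exceeds `s i` with probability at least `1/2`, then the density at `s / 8` is
at most exponentially (in the dimension) smaller than at the origin. -/
theorem LCDensity.le_apply_of_half_le {κ : Type*} [Fintype κ] [Nonempty κ] {F : (κ → ℝ) → ℝ≥0∞}
    (hF : LCDensity F) {Q : Measure (κ → ℝ)} [IsProbabilityMeasure Q]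
    (hQ : Q = (orthant κ).withDensity F) {s : κ → ℝ}
    (hs : ∀ i, 0 < s i) (hhalf : ∀ i, 1 / 2 ≤ Q.real {x | s i < x i}) :
    (64⁻¹ : ℝ≥0∞) ^ Fintype.card κ * F 0 ≤ F ((1 / 8 : ℝ) • s) := by
  have hI : ∫⁻ x, F x ∂orthant κ = 1 := by
    have := measure_univ (μ := Q)
    rwa [hQ, withDensity_apply _ MeasurableSet.univ, setLIntegral_univ] at this
  set C := (64⁻¹ : ℝ≥0∞) ^ Fintype.card κ * F 0 with hC
  set K : Set (κ → ℝ) := {x | 0 ≤ x ∧ C ≤ F x} with hK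
  have hKm : MeasurableSet K :=
    measurableSet_Ici.inter (measurableSet_le measurable_const hF.measurable)
  have hQnn : ∀ᵐ x ∂Q, 0 ≤ x := by
    rw [hQ]
    exact (withDensity_absolutelyContinuous _ _).ae_le (orthant_ae_nonneg κ)
  have hKc : Q.real Kᶜ ≤ 1 / 4 := by
    have h1 : Q Kᶜ ≤ 4⁻¹ := by
      refine le_trans (measure_mono_ae ?_) (hQ ▸ hF.measure_lt_le hI)
      filter_upwards [hQnn] with x hx hxK
      by_contra hlt
      exact hxK ⟨hx, not_lt.1 hlt⟩
    refine (ENNReal.toReal_mono (by simp) h1).trans ?_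
    simp
  have hconv : Convex ℝ K := by
    rw [convex_iff_forall_pos]
    intro x hx y hy a b ha hb hab
    refine ⟨add_nonneg (smul_nonneg ha.le hx.1) (smul_nonneg hb.le hy.1), ?_⟩
    refine le_trans ?_ (hF.logConcave a b ha hb hab x y hx.1 hy.1)
    calc C = C ^ a * C ^ b := by
          rw [← ENNReal.rpow_add_of_nonneg _ _ ha.le hb.le, hab, ENNReal.rpow_one]
      _ ≤ _ := mul_le_mul' (ENNReal.rpow_le_rpow hx.2 ha.le) (ENNReal.rpow_le_rpow hy.2 hb.le)
  have hKpos : 3 / 4 ≤ Q.real K := by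
    have := probReal_add_probReal_compl hKm (μ := Q)
    linarith
  have hK0 : Q K ≠ 0 := by
    intro h
    rw [Measure.real, h] at hKpos
    norm_num at hKpos
  -- `K` is convex and closed under decreasing within the orthant. Truncating at `s` therefore stays
  -- in `K`, and it makes the average exist without any moment assumption.
  have hmem : ∀ x ∈ K, x ⊓ s ∈ K := fun x hx =>
    ⟨le_inf hx.1 fun i => (hs i).le, hx.2.trans (hF.antitone inf_le_left)⟩
  have hint : IntegrableOn (fun x : κ → ℝ => x ⊓ s) K Q := by
    refine Measure.integrableOn_of_bounded (M := ‖s‖) (measure_ne_top _ _)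
      (Measurable.aestronglyMeasurable (measurable_pi_lambda _ fun i =>
        (measurable_pi_apply i).inf measurable_const)) ?_
    filter_upwards [ae_restrict_mem hKm] with x hx
    refine (pi_norm_le_iff_of_nonneg (norm_nonneg _)).2 fun i => ?_
    have h1 : 0 ≤ (x ⊓ s) i := (hmem x hx).1 i
    rw [Real.norm_of_nonneg h1]
    exact (inf_le_right : x i ⊓ s i ≤ s i).trans ((le_abs_self _).trans (norm_le_pi_norm s i))
  have havg : (⨍ x in K, x ⊓ s ∂Q) ∈ closure K :=
    hconv.set_average_mem_closure hK0 (measure_ne_top _ _)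
      ((ae_restrict_mem hKm).mono hmem) hint
  -- Coordinate `i` exceeds `s i` on a part of `K` of mass at least `1/2 - 1/4`, so the average is
  -- at least `s i / 4`. The weaker strict bound is an open condition, which transfers from the
  -- closure of `K` to a point of `K`.
  have hlow : ∀ i, s i / 8 < (⨍ x in K, x ⊓ s ∂Q) i := by
    intro i
    rw [setAverage_eq, Pi.smul_apply, eval_integral fun i => hint.eval i, smul_eq_mul]
    have h1 : s i * (Q.restrict K).real {x | s i ≤ (x ⊓ s) i} ≤ ∫ x in K, (x ⊓ s) i ∂Q := by
      refine mul_meas_ge_le_integral_of_nonneg ?_ (hint.eval i) _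
      filter_upwards [ae_restrict_mem hKm] with x hx using (hmem x hx).1 i
    have h2 : 1 / 4 ≤ (Q.restrict K).real {x | s i ≤ (x ⊓ s) i} := by
      rw [measureReal_restrict_apply' hKm]
      have h3 : {x : κ → ℝ | s i < x i} ⊆ ({x | s i ≤ (x ⊓ s) i} ∩ K) ∪ Kᶜ := by
        intro x hx
        by_cases hxK : x ∈ K
        · exact Or.inl ⟨show s i ≤ x i ⊓ s i from le_inf (le_of_lt hx) le_rfl, hxK⟩
        · exact Or.inr hxK
      have h4 := (measureReal_mono h3 (μ := Q)).trans (measureReal_union_le _ _)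
      linarith [hhalf i]
    have h5 : s i / 4 ≤ ∫ x in K, (x ⊓ s) i ∂Q := by nlinarith [hs i]
    have h6 : 1 ≤ (Q.real K)⁻¹ := (one_le_inv₀ (by linarith)).2 measureReal_le_one
    nlinarith [hs i]
  have hopen : IsOpen {x : κ → ℝ | ∀ i, s i / 8 < x i} := by
    simp only [Set.ofPred_forall]
    exact isOpen_iInter_of_finite fun i => isOpen_lt continuous_const (continuous_apply i)
  obtain ⟨x, hx, hxK⟩ := mem_closure_iff.1 havg _ hopen hlow
  refine hxK.2.trans (hF.antitone fun i => ?_)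
  have := hx i
  simp only [Pi.smul_apply, smul_eq_mul]
  linarith

/-- Log-concavity between `θ` and `y` gives `F (t • θ + (1 - t) • y) ≥ c ^ t * F y`, since `F y ≤ F
0`. Integrating over `y`, the contraction by `1 - t` contributes the power of `1 - t`. -/
theorem LCDensity.le_measure_of_le_apply {κ : Type*} [Fintype κ] {F : (κ → ℝ) → ℝ≥0∞}
    (hF : LCDensity F) (hI : ∫⁻ x, F x ∂orthant κ = 1) {c : ℝ≥0∞} {θ : κ → ℝ} (hθ : 0 ≤ θ)
    (hc : c * F 0 ≤ F θ) {t : ℝ} (ht0 : 0 < t) (ht1 : t < 1) :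
    ENNReal.ofReal (1 - t) ^ Fintype.card κ * c ^ t ≤
      (orthant κ).withDensity F {y | ∀ i, (t • θ) i < y i} := by
  have h1t : 0 < 1 - t := by linarith
  rw [withDensity_setOf_lt F (smul_nonneg ht0.le hθ),
    ← lintegral_orthant_comp_smul (F := fun y => F (t • θ + y))
      (hF.measurable.comp (measurable_const_add (t • θ))) h1t]
  gcongr
  calc c ^ t = ∫⁻ y, c ^ t * F y ∂orthant κ := by
        rw [lintegral_const_mul _ hF.measurable, hI, mul_one]
    _ ≤ _ := lintegral_mono_ae ?_
  filter_upwards [orthant_ae_nonneg κ] with y hy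
  refine le_trans ?_ (hF.logConcave t (1 - t) ht0 h1t (by ring) θ y hθ hy)
  calc c ^ t * F y = c ^ t * (F y ^ t * F y ^ (1 - t)) := by
        rw [← ENNReal.rpow_add_of_nonneg _ _ ht0.le h1t.le]; simp
    _ ≤ c ^ t * (F 0 ^ t * F y ^ (1 - t)) := by
        gcongr
        exact hF.antitone hy
    _ = (c * F 0) ^ t * F y ^ (1 - t) := by
        rw [ENNReal.mul_rpow_of_nonneg _ _ ht0.le, mul_assoc]
    _ ≤ _ := by gcongr

/-- The two previous bounds with `θ = s / 8`. The rate is `7 = 2 + 5`: `1 - t ≥ exp (-2 * t)` for `t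
≤ 1/2`, and `log 64 ≤ 5`. -/
theorem LCMeasure.exp_le_survival {κ : Type*} [Fintype κ] [Nonempty κ] {Q : Measure (κ → ℝ)}
    [IsProbabilityMeasure Q] (hQ : LCMeasure Q) {s : κ → ℝ}
    (hs : ∀ i, 0 < s i) (hhalf : ∀ i, 1 / 2 ≤ Q.real {x | s i < x i}) {t : ℝ} (ht0 : 0 < t)
    (ht1 : t ≤ 1 / 2) :
    Real.exp (-(7 * t * Fintype.card κ)) ≤ Q.real {y | ∀ i, t * s i / 8 < y i} := by
  obtain ⟨F, hF, hQF⟩ := hQ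
  have hI : ∫⁻ x, F x ∂orthant κ = 1 := by
    have := measure_univ (μ := Q)
    rwa [hQF, withDensity_apply _ MeasurableSet.univ, setLIntegral_univ] at this
  have h1 := hF.le_measure_of_le_apply hI (smul_nonneg (by norm_num) fun i => (hs i).le)
    (hF.le_apply_of_half_le hQF hs hhalf) ht0 (by linarith)
  rw [← hQF] at h1
  have h2 : {y : κ → ℝ | ∀ i, (t • (1 / 8 : ℝ) • s) i < y i} = {y | ∀ i, t * s i / 8 < y i} := by
    ext y
    have : ∀ i, (t • (1 / 8 : ℝ) • s) i = t * s i / 8 := fun i => by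
      simp only [Pi.smul_apply, smul_eq_mul]; ring
    simp only [this]
  rw [h2] at h1
  have h3 := ENNReal.toReal_mono (measure_ne_top _ _) h1
  refine le_trans ?_ h3
  rw [ENNReal.toReal_mul, ENNReal.toReal_pow, ENNReal.toReal_ofReal (by linarith),
    ← ENNReal.toReal_rpow, ENNReal.toReal_pow, ENNReal.toReal_inv, ENNReal.toReal_ofNat]
  set m := Fintype.card κ
  have hlog : Real.log 64 ≤ 5 := by
    have : (64 : ℝ) = 2 ^ 6 := by norm_num
    rw [this, Real.log_pow]
    have := Real.log_two_lt_d9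
    push_cast
    linarith
  have h4 : Real.exp (-(2 * t)) ≤ 1 - t := by
    rw [← Real.le_log_iff_exp_le (by linarith)]
    have h5 := Real.one_sub_inv_le_log_of_pos (show 0 < 1 - t by linarith)
    refine le_trans ?_ h5
    have h6 : (1 - t)⁻¹ ≤ 1 + 2 * t := by
      rw [inv_le_iff_one_le_mul₀ (by linarith)]
      nlinarith
    linarith
  have h5 : Real.exp (-(5 * t * m)) ≤ ((64⁻¹ : ℝ) ^ m) ^ t := by
    rw [← Real.rpow_natCast, ← Real.rpow_mul (by norm_num), Real.rpow_def_of_pos (by norm_num),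
      Real.log_inv]
    refine Real.exp_le_exp.2 ?_
    have : 0 ≤ (m : ℝ) * t := by positivity
    nlinarith
  calc _ = Real.exp (-(2 * t)) ^ m * Real.exp (-(5 * t * m)) := by
        rw [← Real.exp_nat_mul, ← Real.exp_add]; congr 1; ring
    _ ≤ _ := mul_le_mul (pow_le_pow_left₀ (Real.exp_nonneg _) h4 _) h5 (Real.exp_nonneg _)
        (pow_nonneg (by linarith) _)

/-! ### One-dimensional estimates -/

/-- An antitone density on the half-line that is log-concave there. -/
structure LCHalfLineDensity (g : ℝ → ℝ≥0∞) : Prop where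
  antitone : Antitone g
  logConcave : ∀ a b : ℝ, 0 < a → 0 < b → a + b = 1 → ∀ x y, 0 ≤ x → 0 ≤ y →
    g x ^ a * g y ^ b ≤ g (a * x + b * y)
  lintegral_eq_one : ∫⁻ x, g x ∂halfLine = 1

theorem LCMeasure.exists_halfLine_density {κ : Type*} [Fintype κ] {Q : Measure (κ → ℝ)}
    [IsProbabilityMeasure Q] (hQ : LCMeasure Q) (e : κ) :
    ∃ g, LCHalfLineDensity g ∧ Q.map (fun x => x e) = halfLine.withDensity g := by
  classical
  obtain ⟨F, hF, hQF'⟩ := hQ.map_subtype (fun i => i = e)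
  have hQF : Q.map (fun (x : κ → ℝ) (i : {i // i = e}) => x i) =
      (orthant {i // i = e}).withDensity F := by
    convert hQF'
  have hmr : Measurable fun (x : κ → ℝ) (i : {i // i = e}) => x i := by fun_prop
  have hmp : MeasurePreserving (MeasurableEquiv.funUnique {i // i = e} ℝ)
      (orthant {i // i = e}) halfLine := by
    convert measurePreserving_funUnique halfLine {i // i = e}
  have hgm : Measurable fun r : ℝ => F fun _ => r := hF.measurable.comp (by fun_prop)
  have hmap : Q.map (fun x => x e) = halfLine.withDensity fun r => F fun _ => r := by
    have h1 : Q.map (fun x => x e) = (Q.map fun (x : κ → ℝ) (i : {i // i = e}) => x i).map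
        (MeasurableEquiv.funUnique {i // i = e} ℝ) := by
      rw [Measure.map_map (MeasurableEquiv.measurable _) hmr]
      rfl
    rw [h1, hQF]
    ext A hA
    rw [MeasurableEquiv.map_apply, withDensity_apply _ hA,
      withDensity_apply _ ((MeasurableEquiv.measurable _) hA),
      ← hmp.setLIntegral_comp_preimage hA hgm]
    refine lintegral_congr fun x => ?_
    congr 1
    ext i
    have : i = default := Subsingleton.elim _ _
    rw [this]
    rfl
  refine ⟨fun r => F fun _ => r, ⟨fun r r' h => hF.antitone fun _ => h, ?_, ?_⟩, hmap⟩
  · intro a b ha hb hab x y hx hy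
    exact hF.logConcave a b ha hb hab (fun _ => x) (fun _ => y) (fun _ => hx) fun _ => hy
  · have := Measure.isProbabilityMeasure_map (μ := Q) (measurable_pi_apply e).aemeasurable
    have h1 := measure_univ (μ := Q.map fun x => x e)
    rwa [hmap, withDensity_apply _ MeasurableSet.univ, setLIntegral_univ] at h1

namespace LCHalfLineDensity

variable {g : ℝ → ℝ≥0∞}

theorem zero_ne_top (hg : LCHalfLineDensity g) : g 0 ≠ ⊤ := by
  intro h
  obtain ⟨t, ht, hgt⟩ := exists_pos_of_lintegral_halfLine_ne_zero (v := g)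
    (by rw [hg.lintegral_eq_one]; exact one_ne_zero)
  have h1 := hg.logConcave (1 / 2) (1 / 2) (by norm_num) (by norm_num) (by norm_num) 0 t le_rfl ht.le
  rw [h, ENNReal.top_rpow_of_pos (by norm_num), ENNReal.top_mul (by simp [hgt]), top_le_iff] at h1
  have h2 := lintegral_halfLine_eq_top hg.antitone (by linarith) h1
  rw [hg.lintegral_eq_one] at h2
  exact ENNReal.one_ne_top h2

theorem zero_ne_zero (hg : LCHalfLineDensity g) : g 0 ≠ 0 := by
  intro h
  obtain ⟨t, ht, hgt⟩ := exists_pos_of_lintegral_halfLine_ne_zero (v := g)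
    (by rw [hg.lintegral_eq_one]; exact one_ne_zero)
  exact hgt (le_antisymm (h ▸ hg.antitone ht.le) bot_le)

theorem ne_top (hg : LCHalfLineDensity g) {x : ℝ} (hx : 0 ≤ x) : g x ≠ ⊤ :=
  ((hg.antitone hx).trans_lt hg.zero_ne_top.lt_top).ne

theorem toReal_zero_pos (hg : LCHalfLineDensity g) : 0 < (g 0).toReal :=
  ENNReal.toReal_pos hg.zero_ne_zero hg.zero_ne_top

/-- With `M = e / g 0`, unit mass and monotonicity give `g M ≤ 1 / M = g 0 / e`. Log-concavity
propagates this decay beyond `M`; before `M` the extra factor `e` makes the bound trivial. -/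
theorem toReal_le_exp (hg : LCHalfLineDensity g) {x : ℝ} (hx : 0 ≤ x) :
    (g x).toReal ≤ (g 0).toReal * Real.exp (1 - x / (Real.exp 1 / (g 0).toReal)) := by
  set g₀ := (g 0).toReal with hg₀
  have h0 : 0 < g₀ := hg.toReal_zero_pos
  set M := Real.exp 1 / g₀ with hM
  have hMpos : 0 < M := div_pos (Real.exp_pos 1) h0
  rcases le_or_gt x M with hxM | hxM
  · have h1 : (g x).toReal ≤ g₀ := ENNReal.toReal_mono hg.zero_ne_top (hg.antitone hx)
    have h2 : x / M ≤ 1 := (div_le_one hMpos).2 hxM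
    have h3 : 1 ≤ Real.exp (1 - x / M) := Real.one_le_exp (by linarith)
    nlinarith
  · have hgM : (g M).toReal ≤ g₀ * Real.exp (-1) := by
      have h1 : g M * ENNReal.ofReal M ≤ 1 := by
        rw [← hg.lintegral_eq_one]
        calc g M * ENNReal.ofReal M = ∫⁻ _ in Set.Icc 0 M, g M := by
              rw [setLIntegral_const, Real.volume_Icc, sub_zero]
          _ ≤ ∫⁻ s in Set.Icc 0 M, g s :=
              setLIntegral_mono' measurableSet_Icc fun s hs => hg.antitone hs.2
          _ ≤ _ := lintegral_mono' (Measure.restrict_mono (fun x hx => hx.1) le_rfl) le_rfl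
      have h2 := ENNReal.toReal_mono ENNReal.one_ne_top h1
      rw [ENNReal.toReal_mul, ENNReal.toReal_ofReal hMpos.le, ENNReal.toReal_one,
        ← le_div_iff₀ hMpos] at h2
      refine h2.trans (le_of_eq ?_)
      rw [hM, Real.exp_neg, one_div_div]
      rfl
    have hxpos : 0 < x := hMpos.trans hxM
    -- `M` is the convex combination of `0` and `x` with weight `b` on `x`.
    set b := M / x with hb
    have hb0 : 0 < b := div_pos hMpos hxpos
    have hb1 : b < 1 := (div_lt_one hxpos).2 hxM
    have h1 := hg.logConcave (1 - b) b (by linarith) hb0 (by ring) 0 x le_rfl hx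
    have h2 : (1 - b) * 0 + b * x = M := by rw [hb]; field_simp; ring
    rw [h2] at h1
    have h3 := ENNReal.toReal_mono (hg.ne_top hMpos.le) h1
    rw [ENNReal.toReal_mul, ← ENNReal.toReal_rpow, ← ENNReal.toReal_rpow, ← hg₀] at h3
    have h4 : g₀ ^ (1 - b) * (g x).toReal ^ b ≤
        g₀ ^ (1 - b) * (g₀ * Real.exp (-(x / M))) ^ b := by
      refine (h3.trans hgM).trans (le_of_eq ?_)
      rw [Real.mul_rpow h0.le (Real.exp_nonneg _), ← mul_assoc, ← Real.rpow_add h0,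
        ← Real.exp_mul]
      have : -(x / M) * b = -1 := by rw [hb]; field_simp
      rw [this, sub_add_cancel, Real.rpow_one]
    have h5 := le_of_mul_le_mul_left h4 (Real.rpow_pos_of_pos h0 _)
    have h6 := (Real.rpow_le_rpow_iff ENNReal.toReal_nonneg (by positivity) hb0).1 h5
    refine h6.trans ?_
    gcongr
    linarith

/-- Integrating the exponential bound gives `2 * e ^ 4 / (g 0) ^ 2`. Here `2 * e ^ 4 < 110`, and
`121` is chosen as a perfect square. -/
theorem lintegral_sq_le (hg : LCHalfLineDensity g) :
    ∫⁻ x, ENNReal.ofReal (x ^ 2) ∂halfLine.withDensity g ≤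
      ENNReal.ofReal (121 / (g 0).toReal ^ 2) := by
  set g₀ := (g 0).toReal with hg₀
  have h0 : 0 < g₀ := hg.toReal_zero_pos
  set M := Real.exp 1 / g₀ with hM
  have hMpos : 0 < M := div_pos (Real.exp_pos 1) h0
  have hgamma := Real.integral_rpow_mul_exp_neg_mul_Ioi (a := 3) (r := 1 / M) (by norm_num)
    (by positivity)
  have hG3 : Real.Gamma 3 = 2 := by
    rw [Real.Gamma_ofNat_eq_factorial]; norm_num [Nat.factorial]
  rw [one_div_one_div, hG3] at hgamma
  have hval : ∫ x in Set.Ioi (0 : ℝ), x ^ 2 * (g₀ * Real.exp (1 - x / M)) =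
      g₀ * Real.exp 1 * (M ^ 3 * 2) := by
    have h3 : (M : ℝ) ^ (3 : ℝ) = M ^ 3 := by exact_mod_cast Real.rpow_natCast M 3
    rw [← h3, ← hgamma, ← integral_const_mul]
    refine setIntegral_congr_fun measurableSet_Ioi fun x _ => ?_
    have h2 : (x : ℝ) ^ ((3 : ℝ) - 1) = x ^ 2 := by
      rw [show (3 : ℝ) - 1 = ((2 : ℕ) : ℝ) by norm_num, Real.rpow_natCast]
    simp only [h2]
    rw [sub_eq_add_neg, Real.exp_add]
    ring_nf
  have hpos : 0 < g₀ * Real.exp 1 * (M ^ 3 * 2) := by positivity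
  have hint : Integrable (fun x => x ^ 2 * (g₀ * Real.exp (1 - x / M)))
      (volume.restrict (Set.Ioi 0)) := by
    by_contra hni
    rw [integral_undef hni] at hval
    linarith
  have hle : g₀ * Real.exp 1 * (M ^ 3 * 2) ≤ 121 / g₀ ^ 2 := by
    rw [hM, le_div_iff₀ (by positivity)]
    have : g₀ * Real.exp 1 * ((Real.exp 1 / g₀) ^ 3 * 2) * g₀ ^ 2 = 2 * Real.exp 1 ^ 4 := by
      field_simp
    rw [this]
    have h1 := Real.exp_one_lt_d9.le
    have h2 : Real.exp 1 ^ 4 ≤ 54.6 :=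
      (pow_le_pow_left₀ (Real.exp_nonneg _) h1 4).trans (by norm_num)
    linarith
  calc _ = ∫⁻ x in Set.Ioi 0, g x * ENNReal.ofReal (x ^ 2) := by
        rw [lintegral_withDensity_eq_lintegral_mul _ hg.antitone.measurable (by fun_prop),
          halfLine, ← restrict_Ioi_eq_restrict_Ici]
        rfl
    _ ≤ ∫⁻ x in Set.Ioi 0, ENNReal.ofReal (x ^ 2 * (g₀ * Real.exp (1 - x / M))) := by
        refine setLIntegral_mono' measurableSet_Ioi fun x hx => ?_
        have hx0 : 0 ≤ x := le_of_lt hx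
        rw [mul_comm, ENNReal.ofReal_mul (sq_nonneg x)]
        gcongr
        rw [← ENNReal.ofReal_toReal (hg.ne_top hx0)]
        exact ENNReal.ofReal_le_ofReal (hg.toReal_le_exp hx0)
    _ = ENNReal.ofReal (g₀ * Real.exp 1 * (M ^ 3 * 2)) := by
        rw [← hval, ofReal_integral_eq_lintegral_ofReal hint]
        exact Filter.Eventually.of_forall fun x => by positivity
    _ ≤ _ := ENNReal.ofReal_le_ofReal hle

theorem integrable_sq (hg : LCHalfLineDensity g) :
    Integrable (fun x => x ^ 2) (halfLine.withDensity g) := by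
  refine ⟨by fun_prop, ?_⟩
  rw [hasFiniteIntegral_iff_ofReal (Filter.Eventually.of_forall fun x => sq_nonneg x)]
  exact hg.lintegral_sq_le.trans_lt ENNReal.ofReal_lt_top

theorem integral_sq_le (hg : LCHalfLineDensity g) :
    ∫ x, x ^ 2 ∂halfLine.withDensity g ≤ 121 / (g 0).toReal ^ 2 := by
  rw [integral_eq_lintegral_of_nonneg_ae (Filter.Eventually.of_forall fun x => sq_nonneg x)
    (by fun_prop)]
  exact ENNReal.toReal_le_of_le_ofReal (by positivity) hg.lintegral_sq_le

theorem isProbabilityMeasure (hg : LCHalfLineDensity g) :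
    IsProbabilityMeasure (halfLine.withDensity g) :=
  ⟨by rw [withDensity_apply _ MeasurableSet.univ, setLIntegral_univ, hg.lintegral_eq_one]⟩

theorem measureReal_Iic_le (hg : LCHalfLineDensity g) {s : ℝ} (hs : 0 ≤ s) :
    (halfLine.withDensity g).real (Set.Iic s) ≤ (g 0).toReal * s := by
  refine ENNReal.toReal_le_of_le_ofReal (by positivity) ?_
  rw [withDensity_apply _ measurableSet_Iic, Measure.restrict_restrict measurableSet_Iic,
    Set.Iic_inter_Ici]
  calc _ ≤ ∫⁻ _ in Set.Icc 0 s, g 0 :=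
        setLIntegral_mono' measurableSet_Icc fun x hx => hg.antitone hx.1
    _ = _ := by
        rw [setLIntegral_const, Real.volume_Icc, sub_zero, ENNReal.ofReal_mul ENNReal.toReal_nonneg,
          ENNReal.ofReal_toReal hg.zero_ne_top]

theorem le_measureReal_Ioi (hg : LCHalfLineDensity g) {s : ℝ} (hs : 0 ≤ s) :
    1 - (g 0).toReal * s ≤ (halfLine.withDensity g).real (Set.Ioi s) := by
  have := hg.isProbabilityMeasure
  have h1 := probReal_add_probReal_compl (μ := halfLine.withDensity g) (measurableSet_Iic (a := s))
  rw [Set.compl_Iic] at h1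
  linarith [hg.measureReal_Iic_le hs]

/-- The root of the second moment is at most `11 / g 0`, and `[0, s]` has mass at most `g 0 * s`;
hence the divisor `22`. -/
theorem half_le_measureReal_Ioi (hg : LCHalfLineDensity g) :
    1 / 2 ≤ (halfLine.withDensity g).real
      (Set.Ioi (√(∫ x, x ^ 2 ∂halfLine.withDensity g) / 22)) := by
  refine le_trans ?_ (hg.le_measureReal_Ioi (by positivity))
  have h0 := hg.toReal_zero_pos
  have h1 : √(∫ x, x ^ 2 ∂halfLine.withDensity g) ≤ 11 / (g 0).toReal := by
    refine Real.sqrt_le_iff.2 ⟨by positivity, hg.integral_sq_le.trans (le_of_eq ?_)⟩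
    rw [div_pow]; norm_num
  rw [le_div_iff₀ h0] at h1
  linarith

theorem integral_sq_pos (hg : LCHalfLineDensity g) : 0 < ∫ x, x ^ 2 ∂halfLine.withDensity g := by
  have h0 := hg.toReal_zero_pos
  have := hg.isProbabilityMeasure
  set s := 1 / (2 * (g 0).toReal) with hs
  have hs0 : 0 < s := by positivity
  have h1 := hg.le_measureReal_Ioi hs0.le
  have h2 : (g 0).toReal * s = 1 / 2 := by rw [hs]; field_simp
  have h3 := mul_meas_ge_le_integral_of_nonneg
    (Filter.Eventually.of_forall fun x => sq_nonneg x) hg.integrable_sq (s ^ 2)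
  have h4 : (halfLine.withDensity g).real (Set.Ioi s) ≤
      (halfLine.withDensity g).real {x | s ^ 2 ≤ x ^ 2} := by
    refine measureReal_mono fun x hx => ?_
    exact pow_le_pow_left₀ hs0.le (le_of_lt hx) 2
  have h5 : 0 < s ^ 2 := by positivity
  nlinarith

/-- A decreasing density has larger average on `[0, s]` than on `(s, 2 * σ]`, so `[0, s]` carries at
least the fraction `s / (2 * σ)` of the mass below `2 * σ`. By Markov's inequality that mass is at
least `3/4`. -/
theorem measureReal_Ioi_le (hg : LCHalfLineDensity g) {σ s : ℝ} (hσ : 0 < σ)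
    (hσg : ∫ x, x ^ 2 ∂halfLine.withDensity g ≤ σ ^ 2) (hs0 : 0 ≤ s) (hs : s ≤ 2 * σ) :
    (halfLine.withDensity g).real (Set.Ioi s) ≤ 1 - 3 / 8 * (s / σ) := by
  have := hg.isProbabilityMeasure
  set ν := halfLine.withDensity g with hν
  have hmarkov : ν.real (Set.Ioi (2 * σ)) ≤ 1 / 4 := by
    have h3 := mul_meas_ge_le_integral_of_nonneg
      (Filter.Eventually.of_forall fun x => sq_nonneg x) hg.integrable_sq ((2 * σ) ^ 2)
    have h4 : ν.real (Set.Ioi (2 * σ)) ≤ ν.real {x | (2 * σ) ^ 2 ≤ x ^ 2} :=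
      measureReal_mono fun x hx => show (2 * σ) ^ 2 ≤ x ^ 2 from
        pow_le_pow_left₀ (by positivity) (le_of_lt hx) 2
    have h5 : (2 * σ) ^ 2 * ν.real {x | (2 * σ) ^ 2 ≤ x ^ 2} ≤ σ ^ 2 := h3.trans hσg
    have h6 : 0 < σ ^ 2 := by positivity
    nlinarith
  have hA : (g s).toReal * s ≤ ν.real (Set.Iic s) := by
    rw [Measure.real, ← ENNReal.toReal_ofReal hs0, ← ENNReal.toReal_mul, ENNReal.toReal_ofReal hs0]
    refine ENNReal.toReal_mono (measure_ne_top _ _) ?_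
    rw [hν, withDensity_apply _ measurableSet_Iic, Measure.restrict_restrict measurableSet_Iic,
      Set.Iic_inter_Ici]
    calc _ = ∫⁻ _ in Set.Icc 0 s, g s := by rw [setLIntegral_const, Real.volume_Icc, sub_zero]
      _ ≤ _ := setLIntegral_mono' measurableSet_Icc fun x hx => hg.antitone hx.2
  have hB : ν.real (Set.Ioc s (2 * σ)) ≤ (g s).toReal * (2 * σ - s) := by
    refine ENNReal.toReal_le_of_le_ofReal
      (mul_nonneg ENNReal.toReal_nonneg (by linarith)) ?_
    have hsub : Set.Ioc s (2 * σ) ∩ Set.Ici 0 = Set.Ioc s (2 * σ) :=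
      Set.inter_eq_left.2 fun x hx => hs0.trans hx.1.le
    rw [hν, withDensity_apply _ measurableSet_Ioc, Measure.restrict_restrict measurableSet_Ioc,
      hsub]
    calc _ ≤ ∫⁻ _ in Set.Ioc s (2 * σ), g s :=
          setLIntegral_mono' measurableSet_Ioc fun x hx => hg.antitone hx.1.le
      _ = _ := by
          rw [setLIntegral_const, Real.volume_Ioc, ENNReal.ofReal_mul ENNReal.toReal_nonneg,
            ENNReal.ofReal_toReal (hg.ne_top hs0)]
  have h1 := probReal_add_probReal_compl (μ := ν) (measurableSet_Iic (a := s))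
  rw [Set.compl_Iic] at h1
  have h2 : ν.real (Set.Ioi s) ≤ ν.real (Set.Ioc s (2 * σ)) + ν.real (Set.Ioi (2 * σ)) := by
    rw [← Set.Ioc_union_Ioi_eq_Ioi hs]
    exact measureReal_union_le _ _
  set A := ν.real (Set.Iic s)
  set B := ν.real (Set.Ioc s (2 * σ))
  have h3 : 3 / 4 ≤ A + B := by linarith
  have h4 : s * B ≤ (2 * σ - s) * A := by
    have h5 := mul_le_mul_of_nonneg_left hB hs0
    have h6 := mul_le_mul_of_nonneg_left hA (show 0 ≤ 2 * σ - s by linarith)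
    linarith
  have h5 : 3 / 8 * (s / σ) ≤ A := by
    rw [← mul_div_assoc, div_le_iff₀ hσ]
    nlinarith
  linarith

end LCHalfLineDensity

/-! ### Tail estimates for coordinates of a log-concave measure -/

namespace LCMeasure

variable {κ : Type*} [Fintype κ] {Q : Measure (κ → ℝ)} [IsProbabilityMeasure Q]

theorem integral_sq_pos (hQ : LCMeasure Q) (e : κ) : 0 < ∫ x, x e ^ 2 ∂Q := by
  obtain ⟨g, hg, hmap⟩ := hQ.exists_halfLine_density e
  have h := hg.integral_sq_pos
  rwa [← hmap, integral_map (measurable_pi_apply e).aemeasurable (by fun_prop)] at h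

theorem half_le_measureReal (hQ : LCMeasure Q) (e : κ) {σ : ℝ} (hσ : σ ≤ √(∫ x, x e ^ 2 ∂Q)) :
    1 / 2 ≤ Q.real {x | σ / 22 < x e} := by
  obtain ⟨g, hg, hmap⟩ := hQ.exists_halfLine_density e
  have h := hg.half_le_measureReal_Ioi
  rw [← hmap, integral_map (measurable_pi_apply e).aemeasurable (by fun_prop),
    map_measureReal_apply (measurable_pi_apply e) measurableSet_Ioi] at h
  refine h.trans (measureReal_mono fun x hx => ?_)
  exact lt_of_le_of_lt (div_le_div_of_nonneg_right hσ (by norm_num)) hx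

theorem measureReal_lt_le (hQ : LCMeasure Q) (e : κ) {σ s : ℝ} (hσ : 0 < σ)
    (hσe : ∫ x, x e ^ 2 ∂Q ≤ σ ^ 2) (hs0 : 0 ≤ s) (hs : s ≤ 2 * σ) :
    Q.real {x | s < x e} ≤ 1 - 3 / 8 * (s / σ) := by
  obtain ⟨g, hg, hmap⟩ := hQ.exists_halfLine_density e
  have h := hg.measureReal_Ioi_le hσ (s := s)
    (by rwa [← hmap, integral_map (measurable_pi_apply e).aemeasurable (by fun_prop)]) hs0 hs
  rwa [← hmap, map_measureReal_apply (measurable_pi_apply e) measurableSet_Ioi] at h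

theorem ae_nonneg {κ : Type*} [Fintype κ] {Q : Measure (κ → ℝ)} (hQ : LCMeasure Q) :
    ∀ᵐ x ∂Q, 0 ≤ x := by
  obtain ⟨F, -, rfl⟩ := hQ
  exact (withDensity_absolutelyContinuous _ _).ae_le (orthant_ae_nonneg κ)

theorem ae_pos {κ : Type*} [Fintype κ] {Q : Measure (κ → ℝ)} (hQ : LCMeasure Q) :
    ∀ᵐ x ∂Q, ∀ i, 0 < x i := by
  obtain ⟨F, -, rfl⟩ := hQ
  refine (withDensity_absolutelyContinuous _ _).ae_le ?_
  filter_upwards [orthant_setOf_lt_ae_eq_Ici (0 : κ → ℝ), orthant_ae_nonneg κ] with x hx h0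
  have hx' : (∀ i, (0 : κ → ℝ) i < x i) = (0 ≤ x) := hx
  exact hx' ▸ h0

/-- Passing to the marginal on `I` makes the exponent depend on `I.card` only. The level has `176 =
8 * 22`. -/
theorem exp_le_survival_finset (hQ : LCMeasure Q) (I : Finset κ) {σ : ℝ} (hσ : 0 < σ)
    (hσI : ∀ e ∈ I, σ ≤ √(∫ x, x e ^ 2 ∂Q)) {t : ℝ} (ht0 : 0 < t) (ht1 : t ≤ 1 / 2) :
    Real.exp (-(7 * t * I.card)) ≤ Q.real {x | ∀ e ∈ I, t * σ / 176 < x e} := by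
  classical
  rcases I.eq_empty_or_nonempty with rfl | ⟨e₀, he₀⟩
  · simp
  have : Nonempty {i // i ∈ I} := ⟨⟨e₀, he₀⟩⟩
  have hmr : Measurable fun (x : κ → ℝ) (i : {i // i ∈ I}) => x i := by fun_prop
  have hprob := Measure.isProbabilityMeasure_map (μ := Q) hmr.aemeasurable
  have hmeas : ∀ (i : {i // i ∈ I}) (r : ℝ), MeasurableSet {x : {i // i ∈ I} → ℝ | r < x i} :=
    fun i r => measurableSet_lt measurable_const (measurable_pi_apply i)
  have hLC : LCMeasure (Q.map fun (x : κ → ℝ) (i : {i // i ∈ I}) => x i) := by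
    convert hQ.map_subtype fun i => i ∈ I
  have h := hLC.exp_le_survival (s := fun _ => σ / 22)
    (fun _ => by positivity) (fun i => by
      rw [map_measureReal_apply hmr (hmeas i _)]
      exact hQ.half_le_measureReal i (hσI i i.2)) ht0 ht1
  rw [map_measureReal_apply hmr (by
    simp only [Set.ofPred_forall]; exact MeasurableSet.iInter fun i => hmeas i _)] at h
  rw [Fintype.card_coe] at h
  refine h.trans (measureReal_mono fun x hx e he => ?_)
  have h1 : t * (σ / 22) / 8 < x e := hx ⟨e, he⟩
  linarith

theorem survival_logConcave_real (hQ : LCMeasure Q) {a b : ℝ} (ha : 0 < a) (hb : 0 < b)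
    (hab : a + b = 1) {x y : κ → ℝ} (hx : 0 ≤ x) (hy : 0 ≤ y) :
    Q.real {z | ∀ i, x i < z i} ^ a * Q.real {z | ∀ i, y i < z i} ^ b ≤
      Q.real {z | ∀ i, (a • x + b • y) i < z i} := by
  have h := ENNReal.toReal_mono (measure_ne_top _ _)
    (hQ.survival_logConcave ha hb hab x y hx hy)
  rwa [ENNReal.toReal_mul, ← ENNReal.toReal_rpow, ← ENNReal.toReal_rpow] at h

/-- Removing one coordinate from a joint tail event at a low level barely changes its
probability. -/
theorem measureReal_erase_mul_le [DecidableEq κ] (hQ : LCMeasure Q) {I : Finset κ} {e : κ}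
    (he : e ∈ I) {σ : ℝ} (hσ : 0 < σ) (hσI : ∀ e ∈ I, σ ≤ √(∫ x, x e ^ 2 ∂Q)) {m : ℝ}
    (hm : I.card ≤ m) {p : ℝ} (hp : 0 < p) (hpσ : 352 * (p / σ) ≤ 1 / 2) :
    Q.real {x | ∀ i ∈ I.erase e, p < x i} *
        (1 - 44 * (p / σ) * (7 * (352 * (p / σ)) * m + 1)) ≤
      Q.real {x | ∀ i ∈ I, p < x i} := by
  set r := 44 * (p / σ) with hr
  have hps : 0 < p / σ := div_pos hp hσ
  have hr0 : 0 < r := by positivity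
  have hr1 : r < 1 := by linarith
  -- Irrelevant coordinates get threshold `0`, which is exceeded almost surely, so both events
  -- become values of the survival function `S`.
  set u : κ → ℝ := fun i => if i ∈ I.erase e then 1 else 0 with hu
  set w : κ → ℝ := fun i => if i = e then 1 else 0 with hw
  have hu0 : 0 ≤ u := fun i => by simp only [hu]; split_ifs <;> simp
  have hw0 : 0 ≤ w := fun i => by simp only [hw]; split_ifs <;> simp
  set S : (κ → ℝ) → ℝ := fun x => Q.real {z | ∀ i, x i < z i} with hS
  have hS0 : ∀ x, 0 ≤ S x := fun x => measureReal_nonneg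
  have hS1 : ∀ x, S x ≤ 1 := fun x => measureReal_le_one
  have hSle : ∀ (x : κ → ℝ) (A : Set (κ → ℝ)), (∀ z, (∀ i, 0 < z i) → z ∈ A → ∀ i, x i < z i) →
      Q.real A ≤ S x := by
    intro x A h
    refine ENNReal.toReal_mono (measure_ne_top _ _) (measure_mono_ae ?_)
    filter_upwards [hQ.ae_pos] with z hz hzA
    exact h z hz hzA
  have hB : Q.real {x | ∀ i ∈ I.erase e, p < x i} ≤ S (p • u) := by
    refine hSle _ _ fun z hz hzA i => ?_
    simp only [Pi.smul_apply, smul_eq_mul, hu]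
    split_ifs with h
    · simpa using hzA i h
    · simpa using hz i
  have hE : Real.exp (-(7 * (352 * (p / σ)) * m)) ≤ S ((2 * p) • u) := by
    have h1 := hQ.exp_le_survival_finset (I.erase e) hσ
      (fun i hi => hσI i (Finset.mem_of_mem_erase hi)) (t := 352 * (p / σ)) (by positivity) hpσ
    have h2 : 352 * (p / σ) * σ / 176 = 2 * p := by field_simp; norm_num
    rw [h2] at h1
    have h3 : ((I.erase e).card : ℝ) ≤ m :=
      le_trans (by exact_mod_cast Finset.card_le_card (Finset.erase_subset e I)) hm
    refine le_trans (Real.exp_le_exp.2 ?_) (h1.trans (hSle _ _ fun z hz hzA i => ?_))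
    · gcongr
    · simp only [Pi.smul_apply, smul_eq_mul, hu]
      split_ifs with h
      · simpa using hzA i h
      · simpa using hz i
  have hH : 1 / 2 ≤ S ((2 * (p / r)) • w) := by
    refine (hQ.half_le_measureReal e (hσI e he)).trans (hSle _ _ fun z hz hzA i => ?_)
    have h1 : 2 * (p / r) = σ / 22 := by rw [hr]; field_simp; norm_num
    simp only [Pi.smul_apply, smul_eq_mul, hw, h1]
    split_ifs with h
    · subst h; simpa using hzA
    · simpa using hz i
  set E := Real.exp (-(7 * (352 * (p / σ)) * m)) with hEdef
  have hm0 : 0 ≤ m := le_trans (by positivity) hm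
  have hE0 : 0 < E := Real.exp_pos _
  -- Here `p / r = σ / 44`. The point is the midpoint of `(2 * p) • u` and `(σ / 22) • w`, where `S`
  -- is at least `E` and `1/2`.
  have hmid : E / 2 ≤ S (p • u + (p / r) • w) := by
    have h1 := hQ.survival_logConcave_real (a := 1 / 2) (b := 1 / 2) (by norm_num) (by norm_num)
      (by norm_num) (smul_nonneg (by positivity) hu0 : 0 ≤ (2 * p) • u)
      (smul_nonneg (by positivity) hw0 : 0 ≤ (2 * (p / r)) • w)
    have h2 : (1 / 2 : ℝ) • (2 * p) • u + (1 / 2 : ℝ) • (2 * (p / r)) • w =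
        p • u + (p / r) • w := by
      rw [smul_smul, smul_smul]; congr 2 <;> ring
    rw [h2] at h1
    refine le_trans ?_ h1
    have h3 : E ≤ S ((2 * p) • u) ^ (1 / 2 : ℝ) :=
      hE.trans (Real.self_le_rpow_of_le_one (hS0 _) (hS1 _) (by norm_num))
    have h4 : 1 / 2 ≤ S ((2 * (p / r)) • w) ^ (1 / 2 : ℝ) :=
      hH.trans (Real.self_le_rpow_of_le_one (hS0 _) (hS1 _) (by norm_num))
    calc E / 2 = E * (1 / 2) := by ring
      _ ≤ _ := mul_le_mul h3 h4 (by norm_num) (by positivity)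
  have hfin := hQ.survival_logConcave_real (a := 1 - r) (b := r) (by linarith) hr0 (by ring)
    (smul_nonneg hp.le hu0 : 0 ≤ p • u)
    (add_nonneg (smul_nonneg hp.le hu0) (smul_nonneg (by positivity) hw0) :
      0 ≤ p • u + (p / r) • w)
  -- Raising coordinate `e` from `0` to the low level `p` is only a fraction `r` of the way to `p /
  -- r`, so log-concavity charges just the power `r` of `E / 2`.
  have hcomb : (1 - r) • p • u + r • (p • u + (p / r) • w) = p • u + p • w := by
    rw [smul_add, smul_smul r (p / r), mul_div_cancel₀ _ hr0.ne', ← add_assoc, ← add_smul]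
    simp
  rw [hcomb] at hfin
  have hA : S (p • u + p • w) ≤ Q.real {x | ∀ i ∈ I, p < x i} := by
    refine measureReal_mono fun z hz i hi => ?_
    have h1 := hz i
    simp only [Pi.add_apply, Pi.smul_apply, smul_eq_mul, hu, hw, Finset.mem_erase] at h1
    by_cases hie : i = e
    · simpa [hie] using h1
    · simpa [hie, hi] using h1
  refine le_trans ?_ (hfin.trans hA)
  have hexp : 1 - r * (7 * (352 * (p / σ)) * m + 1) ≤ S (p • u + (p / r) • w) ^ r := by
    have h1 : (E / 2) ^ r ≤ S (p • u + (p / r) • w) ^ r :=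
      Real.rpow_le_rpow (by positivity) hmid hr0.le
    refine le_trans ?_ h1
    have h2 : Real.exp (-1) ≤ 1 / 2 := by
      rw [Real.exp_neg, one_div]
      exact inv_anti₀ (by norm_num) (by linarith [Real.exp_one_gt_d9])
    have h3 : Real.exp (-(7 * (352 * (p / σ)) * m + 1)) ≤ E / 2 := by
      rw [neg_add, Real.exp_add, div_eq_mul_one_div E]
      exact mul_le_mul_of_nonneg_left h2 hE0.le
    refine le_trans ?_ (Real.rpow_le_rpow (Real.exp_nonneg _) h3 hr0.le)
    rw [← Real.exp_mul]
    have := Real.add_one_le_exp (-(7 * (352 * (p / σ)) * m + 1) * r)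
    linarith
  have hB2 : Q.real {x | ∀ i ∈ I.erase e, p < x i} ≤ S (p • u) ^ (1 - r) :=
    hB.trans (Real.self_le_rpow_of_le_one (hS0 _) (hS1 _) (by linarith))
  exact mul_le_mul_of_nonneg hB2 hexp measureReal_nonneg (Real.rpow_nonneg (hS0 _) _)

end LCMeasure

/-! ### Second moment method and negatively correlated tails -/

/-- Second moment method for a union of almost pairwise negatively correlated events. -/
theorem le_measureReal_iUnion_of_pairwise {α V : Type*} [MeasurableSpace α] [Fintype V]
    {Q : Measure α} [IsProbabilityMeasure Q] {A : V → Set α}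
    (hA : ∀ v, MeasurableSet (A v)) {η : ℝ} (hη1 : η < 1)
    (hpair : ∀ u v, u ≠ v → (1 - η) * Q.real (A u ∩ A v) ≤ Q.real (A u) * Q.real (A v))
    (hE : 0 < ∑ v, Q.real (A v)) :
    2 - 1 / (∑ v, Q.real (A v)) - 1 / (1 - η) ≤ Q.real (⋃ v, A v) := by
  classical
  set E := ∑ v, Q.real (A v) with hEdef
  set f : V → α → ℝ := fun v => (A v).indicator fun _ => 1 with hf
  have hint : ∀ B : Set α, MeasurableSet B → Integrable (B.indicator fun _ => (1 : ℝ)) Q :=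
    fun B hB => (integrable_const 1).indicator hB
  have hval : ∀ B : Set α, MeasurableSet B → ∫ x, B.indicator (fun _ => (1 : ℝ)) x ∂Q = Q.real B :=
    fun B hB => integral_indicator_one hB
  have hmul : ∀ u v x, f u x * f v x = (A u ∩ A v).indicator (fun _ => (1 : ℝ)) x := by
    intro u v x
    simp only [hf, Set.indicator_apply, Set.mem_inter_iff]
    split_ifs <;> simp_all
  have hU : MeasurableSet (⋃ v, A v) := MeasurableSet.iUnion hA
  -- With `N` the number of events that occur, this is `1 - (1 - N / E) ^ 2 ≤ 1`, with equality to
  -- `0` on the left when `N = 0`.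
  have hpt : ∀ x, 2 * E⁻¹ * (∑ v, f v x) - E⁻¹ ^ 2 * (∑ u, ∑ v, f u x * f v x) ≤
      (⋃ v, A v).indicator (fun _ => (1 : ℝ)) x := by
    intro x
    rw [← Finset.sum_mul_sum]
    by_cases hx : x ∈ ⋃ v, A v
    · rw [Set.indicator_of_mem hx]
      nlinarith [sq_nonneg (1 - E⁻¹ * ∑ v, f v x)]
    · rw [Set.indicator_of_notMem hx]
      have : ∑ v, f v x = 0 := Finset.sum_eq_zero fun v _ =>
        Set.indicator_of_notMem (fun h => hx (Set.mem_iUnion.2 ⟨v, h⟩)) _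
      simp [this]
  have hi1 : Integrable (fun x => ∑ v, f v x) Q :=
    integrable_finsetSum _ fun v _ => hint _ (hA v)
  have hi2' : ∀ u v, Integrable (fun x => f u x * f v x) Q := fun u v => by
    simp only [hmul]; exact hint _ ((hA u).inter (hA v))
  have hi2 : Integrable (fun x => ∑ u, ∑ v, f u x * f v x) Q :=
    integrable_finsetSum _ fun u _ => integrable_finsetSum _ fun v _ => hi2' u v
  have h1 := integral_mono ((hi1.const_mul (2 * E⁻¹)).sub (hi2.const_mul (E⁻¹ ^ 2)))
    (hint _ hU) hpt
  have hs1 : ∫ x, ∑ v, f v x ∂Q = E := by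
    rw [integral_finsetSum _ fun v _ => hint _ (hA v)]
    exact Finset.sum_congr rfl fun v _ => hval _ (hA v)
  have hs2 : ∫ x, ∑ u, ∑ v, f u x * f v x ∂Q = ∑ u, ∑ v, Q.real (A u ∩ A v) := by
    rw [integral_finsetSum _ fun u _ => integrable_finsetSum _ fun v _ => hi2' u v]
    refine Finset.sum_congr rfl fun u _ => ?_
    rw [integral_finsetSum _ fun v _ => hi2' u v]
    refine Finset.sum_congr rfl fun v _ => ?_
    simp only [hmul]
    exact hval _ ((hA u).inter (hA v))
  have h1η : 0 < 1 - η := by linarith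
  have hbound : ∑ u, ∑ v, Q.real (A u ∩ A v) ≤ E + E ^ 2 / (1 - η) := by
    have hterm : ∀ u v, Q.real (A u ∩ A v) ≤
        (if u = v then Q.real (A v) else 0) + Q.real (A u) * Q.real (A v) / (1 - η) := by
      intro u v
      have hnn : 0 ≤ Q.real (A u) * Q.real (A v) / (1 - η) := by positivity
      by_cases h : u = v
      · subst h
        simpa using hnn
      · rw [if_neg h, zero_add, le_div_iff₀ h1η, mul_comm]
        exact hpair u v h
    refine (Finset.sum_le_sum fun u _ => Finset.sum_le_sum fun v _ => hterm u v).trans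
      (le_of_eq ?_)
    simp only [Finset.sum_add_distrib, ← Finset.sum_div, ← Finset.mul_sum, ← Finset.sum_mul]
    simp [hEdef, sq]
  have h2 : 2 * E⁻¹ * E - E⁻¹ ^ 2 * (∑ u, ∑ v, Q.real (A u ∩ A v)) ≤ Q.real (⋃ v, A v) := by
    rw [hval _ hU] at h1
    refine le_trans (le_of_eq ?_) h1
    simp only [Pi.sub_apply]
    rw [integral_sub (hi1.const_mul _) (hi2.const_mul _), integral_const_mul, integral_const_mul,
      hs1, hs2]
  have h3 : E⁻¹ ^ 2 * (∑ u, ∑ v, Q.real (A u ∩ A v)) ≤ E⁻¹ ^ 2 * (E + E ^ 2 / (1 - η)) := by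
    gcongr
  have h4 : E⁻¹ ^ 2 * (E + E ^ 2 / (1 - η)) = 1 / E + 1 / (1 - η) := by field_simp
  have h5 : 2 * E⁻¹ * E = 2 := by field_simp
  linarith

/-- Negative correlation of the joint tail events of a law at a common level. -/
def TailsNegativelyCorrelated {κ : Type*} (Q : Measure (κ → ℝ)) : Prop :=
  ∀ I J : Finset κ, Disjoint I J → ∀ p : ℝ, 0 ≤ p →
    Q.real {x | (∀ i ∈ I, p < x i) ∧ ∀ j ∈ J, p < x j} ≤
      Q.real {x | ∀ i ∈ I, p < x i} * Q.real {x | ∀ j ∈ J, p < x j}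

theorem measurableSet_forall_mem_lt {κ : Type*} (I : Finset κ) (p : ℝ) :
    MeasurableSet {x : κ → ℝ | ∀ i ∈ I, p < x i} := by
  simp only [Set.ofPred_forall]
  exact Finset.measurableSet_biInter I fun i _ =>
    measurableSet_lt measurable_const (measurable_pi_apply i)

theorem NegativelyCorrelated.tails_map {Ω : Type*} [MeasurableSpace Ω] {κ : Type*} [Fintype κ]
    {P : Measure Ω} {X : Ω → κ → ℝ} (hX : AEMeasurable X P) (hLC : LCMeasure (P.map X))
    (h : NegativelyCorrelated P X) : TailsNegativelyCorrelated (P.map X) := by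
  intro I J hIJ p hp
  have hnn : ∀ᵐ ω ∂P, 0 ≤ X ω := ae_of_ae_map hX hLC.ae_nonneg
  have hA : ∀ I : Finset κ, (P.map X).real {x | ∀ i ∈ I, p < x i} =
      P.real {ω | ∀ i ∈ I, p < |X ω i|} := by
    intro I
    rw [map_measureReal_apply_of_aemeasurable hX (measurableSet_forall_mem_lt I p)]
    refine measureReal_congr ?_
    filter_upwards [hnn] with ω hω
    refine propext (forall₂_congr fun i _ => ?_)
    rw [abs_of_nonneg (hω i)]
  have hAB : (P.map X).real {x | (∀ i ∈ I, p < x i) ∧ ∀ j ∈ J, p < x j} =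
      P.real {ω | (∀ i ∈ I, p < |X ω i|) ∧ ∀ j ∈ J, p < |X ω j|} := by
    have hm : MeasurableSet {x : κ → ℝ | (∀ i ∈ I, p < x i) ∧ ∀ j ∈ J, p < x j} :=
      (measurableSet_forall_mem_lt I p).inter (measurableSet_forall_mem_lt J p)
    rw [map_measureReal_apply_of_aemeasurable hX hm]
    refine measureReal_congr ?_
    filter_upwards [hnn] with ω hω
    have : ∀ i, |X ω i| = X ω i := fun i => abs_of_nonneg (hω i)
    change ((∀ i ∈ I, p < X ω i) ∧ ∀ j ∈ J, p < X ω j) =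
      ((∀ i ∈ I, p < |X ω i|) ∧ ∀ j ∈ J, p < |X ω j|)
    simp only [this]
  rw [hA I, hA J, hAB]
  exact h I J hIJ (fun _ => p) (fun _ => p) (fun _ _ => hp) fun _ _ => hp

theorem TailsNegativelyCorrelated.le_prod {κ : Type*} {Q : Measure (κ → ℝ)}
    [IsProbabilityMeasure Q] (h : TailsNegativelyCorrelated Q) (I : Finset κ) {p : ℝ}
    (hp : 0 ≤ p) : Q.real {x | ∀ i ∈ I, p < x i} ≤ ∏ i ∈ I, Q.real {x | p < x i} := by
  classical
  induction I using Finset.induction_on with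
  | empty => simp
  | insert e I he ih =>
    rw [Finset.prod_insert he]
    have h1 := h {e} I (Finset.disjoint_singleton_left.2 he) p hp
    simp only [Finset.mem_singleton, forall_eq] at h1
    simp only [Finset.forall_mem_insert]
    exact h1.trans (mul_le_mul_of_nonneg_left ih measureReal_nonneg)

/-! ### Stars and cuts -/

/-- The pairs containing the vertex `v`. -/
def starPairs {n : ℕ} (v : Fin n) : Finset (VertexPair n) :=
  Finset.univ.filter fun e => e.1.1 = v ∨ e.1.2 = v

/-- The pairs with exactly one endpoint in `S`. -/
def cutPairs {n : ℕ} (S : Finset (Fin n)) : Finset (VertexPair n) :=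
  Finset.univ.filter fun e => ¬(e.1.1 ∈ S ↔ e.1.2 ∈ S)

theorem mem_starPairs {n : ℕ} {v : Fin n} {e : VertexPair n} :
    e ∈ starPairs v ↔ e.1.1 = v ∨ e.1.2 = v := by simp [starPairs]

theorem mem_cutPairs {n : ℕ} {S : Finset (Fin n)} {e : VertexPair n} :
    e ∈ cutPairs S ↔ ¬(e.1.1 ∈ S ↔ e.1.2 ∈ S) := by simp [cutPairs]

theorem card_starPairs_le {n : ℕ} (v : Fin n) : (starPairs v).card ≤ n := by
  have h : (starPairs v).card ≤ (Finset.univ : Finset (Fin n)).card := by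
    refine Finset.card_le_card_of_injOn (fun e => if e.1.1 = v then e.1.2 else e.1.1)
      (fun _ _ => Finset.mem_coe.2 (Finset.mem_univ _)) ?_
    rintro ⟨⟨a, b⟩, hab⟩ he ⟨⟨c, d⟩, hcd⟩ he' h
    rw [Finset.mem_coe, mem_starPairs] at he he'
    simp only at he he' h hab hcd
    simp only [Subtype.mk.injEq, Prod.mk.injEq]
    grind
  simpa using h

theorem mul_le_card_cutPairs {n : ℕ} (S : Finset (Fin n)) :
    S.card * (n - S.card) ≤ (cutPairs S).card := by
  have h : (S ×ˢ Sᶜ).card ≤ (cutPairs S).card := by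
    refine Finset.card_le_card_of_surjOn
      (fun e => if e.1.1 ∈ S then (e.1.1, e.1.2) else (e.1.2, e.1.1)) ?_
    rintro ⟨i, j⟩ hij
    rw [Finset.mem_coe, Finset.mem_product, Finset.mem_compl] at hij
    obtain ⟨hi, hj⟩ := hij
    simp only at hi hj
    have hne : i ≠ j := fun h => hj (h ▸ hi)
    rcases lt_or_gt_of_ne hne with hlt | hlt
    · exact ⟨⟨(i, j), hlt⟩, Finset.mem_coe.2 (mem_cutPairs.2 (by simp [hi, hj])), by simp [hi]⟩
    · exact ⟨⟨(j, i), hlt⟩, Finset.mem_coe.2 (mem_cutPairs.2 (by simp [hi, hj])), by simp [hj]⟩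
  simpa [Finset.card_product, Finset.card_compl] using h

/-- The pair formed by `u` and `v` is the only one in both stars. -/
theorem exists_starPairs_sdiff_eq_erase {n : ℕ} {u v : Fin n} (huv : u ≠ v) :
    ∃ e ∈ starPairs v, starPairs v \ starPairs u = (starPairs v).erase e := by
  have key : ∀ e : VertexPair n, e ∈ starPairs v → e ∈ starPairs u →
      starPairs v \ starPairs u = (starPairs v).erase e := by
    rintro ⟨⟨a, b⟩, hab⟩ he he'
    rw [mem_starPairs] at he he'
    ext ⟨⟨c, d⟩, hcd⟩
    rw [Finset.mem_sdiff, Finset.mem_erase, mem_starPairs, mem_starPairs, Ne, Subtype.mk.injEq,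
      Prod.mk.injEq]
    simp only at he he' hab hcd ⊢
    grind
  rcases lt_or_gt_of_ne huv with hlt | hlt
  · exact ⟨⟨(u, v), hlt⟩, mem_starPairs.2 (Or.inr rfl),
      key _ (mem_starPairs.2 (Or.inr rfl)) (mem_starPairs.2 (Or.inl rfl))⟩
  · exact ⟨⟨(v, u), hlt⟩, mem_starPairs.2 (Or.inl rfl),
      key _ (mem_starPairs.2 (Or.inl rfl)) (mem_starPairs.2 (Or.inr rfl))⟩

theorem thresholdGraph_isIsolated {n : ℕ} {x : VertexPair n → ℝ} {p : ℝ} {v : Fin n}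
    (h : ∀ e ∈ starPairs v, p < x e) : (thresholdGraph x p).IsIsolated v := by
  intro w hw
  rw [thresholdGraph, SimpleGraph.fromRel_adj] at hw
  rcases hw.2 with ⟨hlt, hx⟩ | ⟨hlt, hx⟩
  · exact absurd hx (not_le.2 (h _ (mem_starPairs.2 (Or.inl rfl))))
  · exact absurd hx (not_le.2 (h _ (mem_starPairs.2 (Or.inr rfl))))

theorem thresholdGraph_adj_of_le {n : ℕ} {x : VertexPair n → ℝ} {p : ℝ} {e : VertexPair n}
    (h : x e ≤ p) : (thresholdGraph x p).Adj e.1.1 e.1.2 := by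
  rw [thresholdGraph, SimpleGraph.fromRel_adj]
  exact ⟨e.2.ne, Or.inl ⟨e.2, h⟩⟩

/-- The component of some vertex, or its complement if that is smaller, has no edge leaving it. -/
theorem exists_cut_of_not_connected {n : ℕ} (hn : 0 < n) {x : VertexPair n → ℝ} {p : ℝ}
    (h : ¬(thresholdGraph x p).Connected) :
    ∃ S : Finset (Fin n), S.Nonempty ∧ 2 * S.card ≤ n ∧ ∀ e ∈ cutPairs S, p < x e := by
  classical
  have : Nonempty (Fin n) := ⟨⟨0, hn⟩⟩
  rw [SimpleGraph.connected_iff] at h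
  have hpre : ¬(thresholdGraph x p).Preconnected := fun h' => h ⟨h', this⟩
  obtain ⟨u, v, huv⟩ : ∃ u v, ¬(thresholdGraph x p).Reachable u v := by
    by_contra! hc
    exact hpre fun u v => hc u v
  set S : Finset (Fin n) := Finset.univ.filter fun w => (thresholdGraph x p).Reachable u w with hS
  have hmem : ∀ w, w ∈ S ↔ (thresholdGraph x p).Reachable u w := fun w => by simp [hS]
  have hcut : ∀ e ∈ cutPairs S, p < x e := by
    intro e he
    by_contra hle
    have hadj := thresholdGraph_adj_of_le (not_lt.1 hle)
    rw [mem_cutPairs, hmem, hmem] at he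
    exact he ⟨fun hr => hr.trans hadj.reachable, fun hr => hr.trans hadj.symm.reachable⟩
  have hu : u ∈ S := (hmem u).2 (SimpleGraph.Reachable.refl u)
  have hv : v ∉ S := fun hv => huv ((hmem v).1 hv)
  rcases le_or_gt (2 * S.card) n with hle | hgt
  · exact ⟨S, ⟨u, hu⟩, hle, hcut⟩
  · refine ⟨Sᶜ, ⟨v, Finset.mem_compl.2 hv⟩, ?_, fun e he => hcut e ?_⟩
    · rw [Finset.card_compl, Fintype.card_fin]
      omega
    · rw [mem_cutPairs] at he ⊢
      simpa [Finset.mem_compl, not_iff_not] using he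

/-! ### Probability estimates for empty cuts and empty stars -/

theorem measurableSet_biUnion_cut {n : ℕ} (s : ℝ) : MeasurableSet
    (⋃ S ∈ (Finset.univ.filter fun S : Finset (Fin n) => S.Nonempty ∧ 2 * S.card ≤ n),
      {x : VertexPair n → ℝ | ∀ e ∈ cutPairs S, s < x e}) :=
  Finset.measurableSet_biUnion _ fun S _ => measurableSet_forall_mem_lt (cutPairs S) s

/-- The probability that some cut carries no edge is small. -/
theorem LCMeasure.measureReal_biUnion_cut_le {n : ℕ} (hn : 2 ≤ n)
    {Q : Measure (VertexPair n → ℝ)} [IsProbabilityMeasure Q] (hQ : LCMeasure Q)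
    (hNC : TailsNegativelyCorrelated Q) {σ : ℝ} (hσ : 0 < σ)
    (hσe : ∀ e, ∫ x, x e ^ 2 ∂Q ≤ σ ^ 2) (hlog : Real.log n / n ≤ 1 / 8) :
    Q.real (⋃ S ∈ (Finset.univ.filter fun S : Finset (Fin n) => S.Nonempty ∧ 2 * S.card ≤ n),
      {x : VertexPair n → ℝ | ∀ e ∈ cutPairs S, 16 * σ * (Real.log n / n) < x e}) ≤ 2 / n := by
  have hn0 : (0 : ℝ) < n := by exact_mod_cast (by omega : 0 < n)
  have hn2 : (2 : ℝ) ≤ n := by exact_mod_cast hn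
  have hL : 0 < Real.log n := Real.log_pos (by linarith)
  set L := Real.log n with hLdef
  set s := 16 * σ * (L / n) with hs
  have hs0 : 0 ≤ s := by positivity
  have hs2 : s ≤ 2 * σ := by rw [hs]; nlinarith
  -- The factor `6` is `3/8 * 16`; a cut with at least `|S| * n / 2` pairs then gives the exponent
  -- `3 * |S| * log n`.
  have hq : ∀ e, Q.real {x | s < x e} ≤ Real.exp (-(6 * (L / n))) := by
    intro e
    refine (hQ.measureReal_lt_le e hσ (hσe e) hs0 hs2).trans ?_
    have h1 : 3 / 8 * (s / σ) = 6 * (L / n) := by rw [hs]; field_simp; norm_num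
    rw [h1]
    linarith [Real.add_one_le_exp (-(6 * (L / n)))]
  set y := Real.exp (-(3 * L)) with hy
  have hy0 : 0 < y := Real.exp_pos _
  have hS : ∀ S ∈ (Finset.univ.filter fun S : Finset (Fin n) => S.Nonempty ∧ 2 * S.card ≤ n),
      Q.real {x : VertexPair n → ℝ | ∀ e ∈ cutPairs S, s < x e} ≤ y ^ S.card := by
    intro S hS
    obtain ⟨-, hcard⟩ := (Finset.mem_filter.1 hS).2
    have h1 : (S.card : ℝ) * (n / 2) ≤ ((cutPairs S).card : ℝ) := by
      have h2 : ((S.card * (n - S.card) : ℕ) : ℝ) ≤ ((cutPairs S).card : ℝ) := by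
        exact_mod_cast mul_le_card_cutPairs S
      rw [Nat.cast_mul, Nat.cast_sub (by omega)] at h2
      have h3 : 2 * (S.card : ℝ) ≤ n := by exact_mod_cast hcard
      refine le_trans ?_ h2
      gcongr
      linarith
    calc _ ≤ ∏ e ∈ cutPairs S, Q.real {x | s < x e} := hNC.le_prod _ hs0
      _ ≤ ∏ e ∈ cutPairs S, Real.exp (-(6 * (L / n))) :=
          Finset.prod_le_prod (fun _ _ => measureReal_nonneg) fun e _ => hq e
      _ = Real.exp (-(6 * (L / n)) * (cutPairs S).card) := by
          rw [Finset.prod_const, ← Real.exp_nat_mul, mul_comm]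
      _ ≤ Real.exp (-(6 * (L / n)) * (S.card * (n / 2))) := by
          refine Real.exp_le_exp.2 ?_
          have : 0 ≤ 6 * (L / n) := by positivity
          nlinarith
      _ = y ^ S.card := by
          rw [hy, ← Real.exp_nat_mul]
          congr 1
          field_simp
          ring
  -- Binomial expansion over all vertex sets, with the empty set removed.
  have hsum : ∑ S ∈ (Finset.univ.filter fun S : Finset (Fin n) => S.Nonempty ∧ 2 * S.card ≤ n),
      y ^ S.card ≤ (1 + y) ^ n - 1 := by
    have h1 := Finset.prod_one_add (R := ℝ) (Finset.univ : Finset (Fin n)) (f := fun _ => y)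
    simp only [Finset.prod_const, Finset.card_univ, Fintype.card_fin, Finset.powerset_univ] at h1
    rw [h1, ← Finset.add_sum_erase _ _ (Finset.mem_univ ∅), Finset.card_empty, pow_zero,
      add_sub_cancel_left]
    refine Finset.sum_le_sum_of_subset_of_nonneg (fun S hS => ?_) fun _ _ _ => by positivity
    exact Finset.mem_erase.2 ⟨(Finset.mem_filter.1 hS).2.1.ne_empty, Finset.mem_univ _⟩
  have hyn : (n : ℝ) * y ≤ 1 / n := by
    have h1 : Real.exp (-L) = 1 / n := by
      rw [Real.exp_neg, hLdef, Real.exp_log hn0, one_div]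
    have h2 : y ≤ Real.exp (-L) * Real.exp (-L) := by
      rw [← Real.exp_add]
      exact Real.exp_le_exp.2 (by linarith)
    rw [h1] at h2
    calc (n : ℝ) * y ≤ n * (1 / n * (1 / n)) := by gcongr
      _ = 1 / n := by field_simp
  have hexp : (1 + y) ^ n ≤ Real.exp (n * y) := by
    rw [Real.exp_nat_mul, add_comm]
    exact pow_le_pow_left₀ (by positivity) (Real.add_one_le_exp y) n
  have h1n : (1 : ℝ) / n ≤ 1 := (div_le_one hn0).2 (by linarith)
  have hny : 0 ≤ (n : ℝ) * y := by positivity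
  have hfin := le_of_abs_le (Real.abs_exp_sub_one_le (x := n * y)
    (by rw [abs_of_nonneg hny]; linarith))
  rw [abs_of_nonneg hny] at hfin
  calc _ ≤ _ := measureReal_biUnion_finset_le _ _
    _ ≤ _ := Finset.sum_le_sum hS
    _ ≤ (1 + y) ^ n - 1 := hsum
    _ ≤ 2 * (n * y) := by linarith
    _ ≤ 2 * (1 / n) := by linarith
    _ = 2 / n := by ring

/-- With high probability some star carries no edge. -/
theorem LCMeasure.le_measureReal_iUnion_star {n : ℕ} (hn : 2 ≤ n) {δ : ℝ} (hδ1 : δ < 1)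
    (hδ0 : 0 < δ) {Q : Measure (VertexPair n → ℝ)} [IsProbabilityMeasure Q] (hQ : LCMeasure Q)
    (hNC : TailsNegativelyCorrelated Q) {σ : ℝ} (hσ : 0 < σ)
    (hσe : ∀ e, σ ≤ √(∫ x, x e ^ 2 ∂Q)) :
    1 - (2 + 2 * (4 / (1 - δ) ^ 2 + 2 / (1 - δ))) * (n : ℝ) ^ (-δ) <
      Q.real (⋃ v : Fin n, {x : VertexPair n → ℝ |
        ∀ e ∈ starPairs v, (1 - δ) / 2464 * σ * (Real.log n / n) < x e}) := by
  have hn0 : (0 : ℝ) < n := by exact_mod_cast (by omega : 0 < n)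
  have hn2 : (2 : ℝ) ≤ n := by exact_mod_cast hn
  have hL : 0 < Real.log n := Real.log_pos (by linarith)
  have hLn : Real.log n ≤ n := (Real.log_le_sub_one_of_pos hn0).trans (by linarith)
  set L := Real.log n with hLdef
  have hd : 0 < 1 - δ := by linarith
  set p := (1 - δ) / 2464 * σ * (L / n) with hp
  have hLn0 : 0 < L / n := by positivity
  have hLn1 : L / n ≤ 1 := (div_le_one hn0).2 hLn
  have hp0 : 0 < p := by positivity
  have hpσ : p / σ = (1 - δ) / 2464 * (L / n) := by rw [hp]; field_simp
  have hpσ2 : 352 * (p / σ) ≤ 1 / 2 := by rw [hpσ]; nlinarith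
  set N := (n : ℝ) ^ (-δ) with hN
  have hN0 : 0 < N := Real.rpow_pos_of_pos hn0 _
  set K := 4 / (1 - δ) ^ 2 + 2 / (1 - δ) with hK
  have hK0 : 0 < K := by positivity
  set A : Fin n → Set (VertexPair n → ℝ) := fun v => {x | ∀ e ∈ starPairs v, p < x e} with hA
  set η := 44 * (p / σ) * (7 * (352 * (p / σ)) * n + 1) with hη
  -- `η` is of order `log² n / n`, and `log n` is at most a constant times `n ^ ((1 - δ) / 2)`.
  have hηN : η ≤ K * N := by
    have hlog : L ≤ (n : ℝ) ^ ((1 - δ) / 2) / ((1 - δ) / 2) :=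
      Real.log_le_rpow_div hn0.le (by linarith)
    set R := (n : ℝ) ^ ((1 - δ) / 2) with hR
    have hR1 : 1 ≤ R := Real.one_le_rpow (by linarith) (by linarith)
    have hRR : R * R = n * N := by
      rw [hR, hN, ← Real.rpow_add hn0]
      nth_rewrite 2 [← Real.rpow_one (n : ℝ)]
      rw [← Real.rpow_add hn0]
      congr 1; ring
    have hLR : L ≤ 2 / (1 - δ) * R := by
      refine hlog.trans (le_of_eq ?_)
      field_simp
    have hLL : L * L ≤ 4 / (1 - δ) ^ 2 * (n * N) := by
      calc L * L ≤ (2 / (1 - δ) * R) * (2 / (1 - δ) * R) := mul_self_le_mul_self hL.le hLR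
        _ = 4 / (1 - δ) ^ 2 * (R * R) := by field_simp; norm_num
        _ = _ := by rw [hRR]
    have hL1 : L ≤ 2 / (1 - δ) * (n * N) := by
      refine hLR.trans ?_
      rw [← hRR]
      gcongr
      nlinarith
    have h1 : η = 44 * (1 - δ) / 2464 * (L * ((1 - δ) * L + 1)) / n := by
      rw [hη, hpσ]; field_simp; ring
    rw [h1, div_le_iff₀ hn0]
    have h2 : L * ((1 - δ) * L + 1) ≤ K * N * n := by
      rw [hK]
      have : (1 - δ) * (L * L) ≤ 1 * (L * L) := by
        gcongr
        linarith
      nlinarith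
    have h3 : 44 * (1 - δ) / 2464 ≤ 1 := by linarith
    have h4 : 0 ≤ L * ((1 - δ) * L + 1) := by positivity
    nlinarith
  have hη0 : 0 ≤ η := by positivity
  -- If `η > 1/2`, then `K * N > 1/2` and the claimed lower bound is negative.
  rcases lt_or_ge (1 / 2) η with hbig | hsmall
  · have : (2 + 2 * K) * N > 1 := by nlinarith
    linarith [measureReal_nonneg (μ := Q) (s := ⋃ v : Fin n, A v)]
  have hcardle : ∀ v : Fin n, ((starPairs v).card : ℝ) ≤ n := fun v => by
    exact_mod_cast card_starPairs_le v
  have hpair : ∀ u v : Fin n, u ≠ v →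
      (1 - η) * Q.real (A u ∩ A v) ≤ Q.real (A u) * Q.real (A v) := by
    intro u v huv
    obtain ⟨e, he, hse⟩ := exists_starPairs_sdiff_eq_erase huv
    have h1 := hNC (starPairs u) (starPairs v \ starPairs u) Finset.disjoint_sdiff p hp0.le
    have h2 := hQ.measureReal_erase_mul_le he hσ (fun i _ => hσe i) (hcardle v) hp0 hpσ2
    rw [← hse] at h2
    have h3 : Q.real (A u ∩ A v) ≤ Q.real {x | (∀ i ∈ starPairs u, p < x i) ∧
        ∀ j ∈ starPairs v \ starPairs u, p < x j} :=
      measureReal_mono fun x hx => ⟨hx.1, fun j hj => hx.2 j (Finset.mem_sdiff.1 hj).1⟩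
    calc (1 - η) * Q.real (A u ∩ A v)
        ≤ (1 - η) * (Q.real (A u) * Q.real {x | ∀ j ∈ starPairs v \ starPairs u, p < x j}) :=
          mul_le_mul_of_nonneg_left (h3.trans h1) (by linarith)
      _ = Q.real (A u) * (Q.real {x | ∀ j ∈ starPairs v \ starPairs u, p < x j} * (1 - η)) := by
          ring
      _ ≤ _ := mul_le_mul_of_nonneg_left h2 measureReal_nonneg
  -- Since `2464 = 2 * 7 * 176`, the survival exponent is at most `(1 - δ) / 2 * log n`, with a
  -- factor 2 to spare.
  have hEach : ∀ v : Fin n, (n : ℝ) ^ (-(1 - δ)) ≤ Q.real (A v) := by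
    intro v
    have h1 := hQ.exp_le_survival_finset (starPairs v) hσ (fun i _ => hσe i)
      (t := 176 * (p / σ)) (by positivity) (by linarith [div_pos hp0 hσ])
    have h2 : 176 * (p / σ) * σ / 176 = p := by field_simp
    rw [h2] at h1
    refine le_trans ?_ h1
    rw [Real.rpow_def_of_pos hn0]
    refine Real.exp_le_exp.2 ?_
    have h3 : 7 * (176 * (p / σ)) * (starPairs v).card ≤ 7 * (176 * (p / σ)) * n :=
      mul_le_mul_of_nonneg_left (hcardle v) (by positivity)
    have h4 : 7 * (176 * (p / σ)) * n = (1 - δ) / 2 * L := by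
      rw [hpσ]; field_simp; norm_num
    have h5 : 0 < (1 - δ) * L := by positivity
    nlinarith
  set E := ∑ v, Q.real (A v) with hE
  have hEn : N⁻¹ ≤ E := by
    calc N⁻¹ = ∑ _ : Fin n, (n : ℝ) ^ (-(1 - δ)) := by
          rw [Finset.sum_const, Finset.card_univ, Fintype.card_fin, nsmul_eq_mul, hN,
            ← Real.rpow_neg hn0.le]
          nth_rewrite 2 [← Real.rpow_one (n : ℝ)]
          rw [← Real.rpow_add hn0]
          congr 1; ring
      _ ≤ E := Finset.sum_le_sum fun v _ => hEach v
  have hE0 : 0 < E := lt_of_lt_of_le (inv_pos.2 hN0) hEn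
  have hmain := le_measureReal_iUnion_of_pairwise (Q := Q) (A := A)
    (fun v => measurableSet_forall_mem_lt _ _) (by linarith) hpair hE0
  have h1 : 1 / E ≤ N := by
    rw [one_div]
    exact inv_le_of_inv_le₀ hN0 hEn
  have h2 : 1 / (1 - η) ≤ 1 + 2 * η := by
    rw [div_le_iff₀ (by linarith)]
    nlinarith
  refine lt_of_lt_of_le ?_ hmain
  rw [← hE]
  linarith

/-! ### The main theorem -/

/-- Events that contain the preimage of a measurable set have at least its probability. -/
theorem measureReal_map_le_of_subset {Ω α : Type*} [MeasurableSpace Ω] [MeasurableSpace α]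
    {P : Measure Ω} [IsFiniteMeasure P] {X : Ω → α} (hX : AEMeasurable X P) {B : Set α}
    (hB : MeasurableSet B) {S : Set Ω} (h : X ⁻¹' B ⊆ S) : (P.map X).real B ≤ P.real S := by
  rw [map_measureReal_apply_of_aemeasurable hX hB]
  exact measureReal_mono h

theorem log_div_self_le_of_ge {x : ℝ} (hx : 256 ≤ x) : Real.log x / x ≤ 1 / 8 := by
  have h0 : 0 < x := by linarith
  have h1 : 16 ≤ √x := by
    rw [show (16 : ℝ) = √256 by
      rw [show (256 : ℝ) = 16 ^ 2 by norm_num, Real.sqrt_sq (by norm_num)]]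
    exact Real.sqrt_le_sqrt hx
  have h2 : Real.log x ≤ 2 * √x := by
    have := Real.log_le_sub_one_of_pos (Real.sqrt_pos.2 h0)
    rw [Real.log_sqrt h0.le] at this
    linarith
  have h3 := Real.mul_self_sqrt h0.le
  rw [div_le_iff₀ h0]
  nlinarith

theorem theorem1 (δ : ℝ) (hδ0 : 0 < δ) (hδ1 : δ < 1) :
    (∃ c₁ : ℝ, 0 < c₁ ∧ ∃ c₂ : ℝ, 0 < c₂ ∧
      ∀ (n : ℕ), 2 ≤ n → ∀ (Ω : Type*) [MeasurableSpace Ω] (P : Measure Ω) [IsProbabilityMeasure P]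
        (X : Ω → VertexPair n → ℝ), HasLogConcaveDownMonotoneDensity P X →
        NegativelyCorrelated P X → ∀ p : ℝ, p < c₁ * sigmaMin P X * (Real.log n / n) →
        P.real {ω | HasIsolatedVertex (thresholdGraph (X ω) p)} > 1 - c₂ * (n : ℝ) ^ (-δ)) ∧
    (∃ C₁ : ℝ, 0 < C₁ ∧ ∃ C₂ : ℝ, 0 < C₂ ∧
      ∀ (n : ℕ), 2 ≤ n → ∀ (Ω : Type*) [MeasurableSpace Ω] (P : Measure Ω) [IsProbabilityMeasure P]
        (X : Ω → VertexPair n → ℝ), HasLogConcaveDownMonotoneDensity P X →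
        NegativelyCorrelated P X → ∀ p : ℝ, p > C₁ * sigmaMax P X * (Real.log n / n) →
        P.real {ω | (thresholdGraph (X ω) p).Connected} > 1 - C₂ * (n : ℝ) ^ (-δ)) := by
  have hd : 0 < 1 - δ := by linarith
  refine ⟨⟨(1 - δ) / 2464, by positivity, 2 + 2 * (4 / (1 - δ) ^ 2 + 2 / (1 - δ)), by positivity,
    ?_⟩, ⟨16, by norm_num, 257, by norm_num, ?_⟩⟩
  · intro n hn Ω _ P _ X hX hNC p hp
    have hQ := hX.lcMeasure_map
    have hprob := Measure.isProbabilityMeasure_map (μ := P) hX.1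
    have hsq : ∀ e, ∫ x, x e ^ 2 ∂P.map X = ∫ ω, X ω e ^ 2 ∂P := fun e =>
      integral_map hX.1 (((measurable_pi_apply e).pow_const 2).aestronglyMeasurable)
    have : Nonempty (VertexPair n) := ⟨⟨(⟨0, by omega⟩, ⟨1, by omega⟩), by simp [Fin.lt_def]⟩⟩
    have hσ : 0 < sigmaMin P X := by
      obtain ⟨e, he⟩ := exists_eq_ciInf_of_finite (f := fun e => ∫ ω, X ω e ^ 2 ∂P)
      rw [sigmaMin, ← he, ← hsq]
      exact Real.sqrt_pos.2 (hQ.integral_sq_pos e)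
    have hσe : ∀ e, sigmaMin P X ≤ √(∫ x, x e ^ 2 ∂P.map X) := fun e => by
      rw [hsq]
      exact Real.sqrt_le_sqrt (ciInf_le (Set.finite_range _).bddBelow e)
    refine lt_of_lt_of_le (hQ.le_measureReal_iUnion_star hn hδ1 hδ0
      (hNC.tails_map hX.1 hQ) hσ hσe) ?_
    refine measureReal_map_le_of_subset hX.1
      (MeasurableSet.iUnion fun v => measurableSet_forall_mem_lt _ _) fun ω hω => ?_
    obtain ⟨v, hv⟩ := Set.mem_iUnion.1 hω
    exact ⟨v, thresholdGraph_isIsolated fun e he => hp.trans (hv e he)⟩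
  · intro n hn Ω _ P _ X hX hNC p hp
    have hQ := hX.lcMeasure_map
    have hprob := Measure.isProbabilityMeasure_map (μ := P) hX.1
    have hn0 : (0 : ℝ) < n := by exact_mod_cast (by omega : 0 < n)
    have hn1 : (1 : ℝ) ≤ n := by exact_mod_cast (by omega : 1 ≤ n)
    have hinv : (n : ℝ)⁻¹ ≤ (n : ℝ) ^ (-δ) := by
      rw [← Real.rpow_neg_one]
      exact Real.rpow_le_rpow_of_exponent_le hn1 (by linarith)
    have hinv0 : 0 < (n : ℝ)⁻¹ := inv_pos.2 hn0
    -- The cut estimate needs `log n / n ≤ 1 / 8`, guaranteed for `n ≥ 256`. The constant `257`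
    -- makes the claim trivial for smaller `n`, and also exceeds the `2` needed for larger `n`.
    rcases le_or_gt (n : ℝ) 256 with hsmall | hlarge
    · have h1 : 257 * (n : ℝ)⁻¹ > 1 := by
        rw [gt_iff_lt, ← div_eq_mul_inv, lt_div_iff₀ hn0]
        linarith
      linarith [measureReal_nonneg (μ := P) (s := {ω | (thresholdGraph (X ω) p).Connected})]
    have hsq : ∀ e, ∫ x, x e ^ 2 ∂P.map X = ∫ ω, X ω e ^ 2 ∂P := fun e =>
      integral_map hX.1 (((measurable_pi_apply e).pow_const 2).aestronglyMeasurable)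
    have hle : ∀ e, ∫ ω, X ω e ^ 2 ∂P ≤ ⨆ e, ∫ ω, X ω e ^ 2 ∂P := fun e =>
      le_ciSup (f := fun e => ∫ ω, X ω e ^ 2 ∂P) (Set.finite_range _).bddAbove e
    have hsup : 0 < ⨆ e, ∫ ω, X ω e ^ 2 ∂P := by
      refine lt_of_lt_of_le ?_ (hle ⟨(⟨0, by omega⟩, ⟨1, by omega⟩), by simp [Fin.lt_def]⟩)
      rw [← hsq]
      exact hQ.integral_sq_pos _
    have hσ : 0 < sigmaMax P X := Real.sqrt_pos.2 hsup
    have hσe : ∀ e, ∫ x, x e ^ 2 ∂P.map X ≤ sigmaMax P X ^ 2 := fun e => by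
      rw [hsq, sigmaMax, Real.sq_sqrt hsup.le]
      exact hle e
    have hcut := hQ.measureReal_biUnion_cut_le hn (hNC.tails_map hX.1 hQ) hσ hσe
      (log_div_self_le_of_ge hlarge.le)
    have hm := measurableSet_biUnion_cut (n := n) (16 * sigmaMax P X * (Real.log n / n))
    have hcompl := probReal_add_probReal_compl hm (μ := P.map X)
    have hconn := measureReal_map_le_of_subset hX.1 hm.compl
      (S := {ω | (thresholdGraph (X ω) p).Connected}) fun ω hω => by
        by_contra hnc
        obtain ⟨S, hS, hcard, hSp⟩ := exists_cut_of_not_connected (by omega) hnc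
        refine hω (Set.mem_iUnion₂.2 ⟨S, Finset.mem_filter.2 ⟨Finset.mem_univ _, hS, hcard⟩, ?_⟩)
        exact fun e he => lt_trans hp (hSp e he)
    rw [div_eq_mul_inv (2 : ℝ)] at hcut
    linarith
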